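/- **Setting.** Let $\mathcal B_\infty$ be the rooted infinite binary tree with root $o$. For a finite rooted subtree $T\ni o$ of $\mathcal B_\infty$, a stable configuration is $\eta\in\{1,2,3\}^T$; it is recurrent (allowed) if there is no nonempty $S\subseteq T$ such that for every $u\in S$ the height $\eta_u$ is at most the number of neighbours of $u$ in $S$. Let $\mu_T$ be the uniform measure on the recurrent configurations of $T$; for an infinite rooted subtree $T$ let $\mu_T$ be the weak limit of $\mu_{T'}$ along the net of finite rooted subtrees $T'\uparrow T$. Let $Cov(u,v,T)$ be the covariance of $\eta_u$ and $\eta_v$ under $\mu_T$. A recurrent configuration of a finite rooted tree $T$ is strongly allowed if it remains allowed after attaching to the root of $T$ a new vertex of height $1$, and weakly allowed otherwise; the characteristic ratio $x(T)$ is the number of weakly allowed configurations divided by the number of strongly allowed ones. Let $p\in(0,1]$ and let $\mathcal T$ be the random binary tree with root $o$: each individual independently has two children with probability $p$ and none with probability $1-p$. Let $\mathcal T_N$ be its restriction to the generations $0,\dots,N$. For each $n$ let $v(n)$ be a fixed vertex of $\mathcal B_\infty$ at distance $n$ from $o$, and let $\mathcal T[o,n]$ be $\mathcal T$ conditioned to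 contain $v(n)$, that is, to contain the path from $o$ to $v(n)$. **Theorem.** The random variables $x(\mathcal T_N)$ converge in distribution as $N\to\infty$; let $x_1$ have the limiting law, and let $\gamma$ be given by $\gamma^{-1}=\mathbb E\big((1+x_1)^{-1}\big)$. The measure $\mu_T$ exists for every finite or infinite rooted subtree $T$ of $\mathcal B_\infty$. For every $n$, $Cov(o,v(n),\mathcal T[o,n])$ is integrable and $\mathbb E|Cov(o,v(n),\mathcal T[o,n])|>0$, the limit below exists, and $$\lim_{n\to\infty}\frac1n\Big(-\log \mathbb E\big|Cov(o,v(n),\mathcal T[o,n])\big|\Big)\le \log\frac{\Lambda_+(\gamma)}{\Lambda_-(\gamma)}\le\log\frac{4+\sqrt7}{4-\sqrt7},\qquad \Lambda_\pm(\gamma)=\frac{2\gamma+1\pm\sqrt{4\gamma+1}}2 .$$ -/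

import Mathlib

open MeasureTheory ProbabilityTheory Filter Topology

noncomputable section

namespace TreeSandpile

/-- Vertices of the rooted infinite binary tree: finite binary words. The root is `[]`, the
children of `u` are `u ++ [false]` and `u ++ [true]`, and `u.length` is the distance from
the root to `u`. -/
abbrev Vertex := List Bool

/-- The rooted infinite binary tree as a graph. -/
def binaryTree : SimpleGraph Vertex where
  Adj u v := (∃ b, v = u ++ [b]) ∨ (∃ b, u = v ++ [b])
  symm := ⟨fun _ _ h => h.symm⟩
  loopless := ⟨by rintro u (⟨b, h⟩ | ⟨b, h⟩) <;> simp at h⟩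

/-- Rooted subtrees of the infinite binary tree: sets of vertices that contain the root and,
with every vertex, all its ancestors. -/
def IsRootedSubtree (T : Set Vertex) : Prop :=
  [] ∈ T ∧ ∀ u v : Vertex, u <+: v → v ∈ T → u ∈ T

/-! ### The sandpile model on finite subtrees -/

/-- Height configurations with heights `1, 2, 3` on the vertices of a subtree. The value `0` is
reserved for the vertices that do not belong to the subtree, so that all the subtrees share one
configuration space. -/
abbrev Config := Vertex → Fin 4

/-- Number of neighbours of `u` in `S`. -/
def numNeighbors (S : Finset Vertex) (u : Vertex) : ℕ :=
  ((S : Set Vertex) ∩ {v | binaryTree.Adj u v}).ncard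

/-- `η` is a stable configuration on `T`: heights in `{1, 2, 3}` on `T`
(and the marker `0` off `T`). -/
def IsStable (T : Finset Vertex) (η : Config) : Prop :=
  ∀ u, u ∈ T ↔ η u ≠ 0

/-- `η` contains a forbidden subconfiguration in `T`: a nonempty `S ⊆ T` such that for all `u ∈ S`
the height at `u` is at most the number of neighbours of `u` in `S`. -/
def HasFSC (T : Finset Vertex) (η : Config) : Prop :=
  ∃ S ⊆ T, S.Nonempty ∧ ∀ u ∈ S, (η u : ℕ) ≤ numNeighbors S u

/-- The set of recurrent (i.e. allowed) stable configurations on the finite tree `T`. -/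
def recurrent (T : Finset Vertex) : Set Config :=
  {η | IsStable T η ∧ ¬ HasFSC T η}

lemma finite_recurrent (T : Finset Vertex) : (recurrent T).Finite := by
  classical
  refine Set.Finite.subset (s := Set.range
    (fun (g : T → Fin 4) (u : Vertex) => if h : u ∈ T then g ⟨u, h⟩ else 0))
    (Set.finite_range _) ?_
  rintro η ⟨hη, -⟩
  refine ⟨fun u => η u, ?_⟩
  funext u
  by_cases h : u ∈ T
  · simp [h]
  · have : η u = 0 := by
      by_contra h0
      exact h ((hη u).2 h0)
    simp [h, this]

lemma recurrent_nonempty (T : Finset Vertex) : (recurrent T).Nonempty := by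
  classical
  refine ⟨fun u => if u ∈ T then 3 else 0, ?_, ?_⟩
  · intro u
    by_cases h : u ∈ T <;> simp [h]
  · rintro ⟨S, hST, hS, h⟩
    obtain ⟨u, huS, hu⟩ := S.exists_max_image List.length hS
    have h1 := h u huS
    have h2 : numNeighbors S u ≤ 1 := by
      have hsub : ((S : Set Vertex) ∩ {v | binaryTree.Adj u v}) ⊆ {u.dropLast} := by
        rintro v ⟨hvS, ⟨b, hv⟩ | ⟨b, hv⟩⟩
        · have := hu v hvS
          simp [hv] at this
        · simp [hv]
      simpa [numNeighbors] using Set.ncard_le_ncard hsub (Set.finite_singleton _)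
    have h3 : u ∈ T := hST huS
    simp only [h3, if_true] at h1
    have h4 : ((3 : Fin 4) : ℕ) = 3 := rfl
    omega

/-- The uniform measure on the recurrent configurations of the finite tree `T`. -/
def finiteSandpileMeasure (T : Finset Vertex) : ProbabilityMeasure Config :=
  ⟨uniformOn (recurrent T),
    isProbabilityMeasure_uniformOn (finite_recurrent T) (recurrent_nonempty T)⟩

/-! ### The sandpile measure of a general subtree -/

/-- Finite rooted subtrees of `T`, ordered by inclusion. -/
abbrev FiniteSubtree (T : Set Vertex) :=
  {S : Finset Vertex // IsRootedSubtree (S : Set Vertex) ∧ (S : Set Vertex) ⊆ T}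

/-- `μ` is the sandpile measure of the finite or infinite rooted subtree `T`: the weak limit of
the uniform measures on the recurrent configurations of `T'`, along the net of finite
subtrees `T' ↑ T`. If `T` is finite, then this is the uniform measure on its recurrent
configurations. -/
def IsSandpileMeasure (T : Set Vertex) (μ : ProbabilityMeasure Config) : Prop :=
  Tendsto (fun T' : FiniteSubtree T => finiteSandpileMeasure T'.1) atTop (𝓝 μ)

/-- Covariance of the heights at `u` and `v` under `μ`. -/
def heightCov (μ : ProbabilityMeasure Config) (u v : Vertex) : ℝ :=
  covariance (fun η : Config => ((η u : ℕ) : ℝ)) (fun η : Config => ((η v : ℕ) : ℝ))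
    (μ : Measure Config)

/-! ### The characteristic ratio of a finite rooted tree -/

/-- Extension of a finite rooted tree by one vertex attached to its root by an edge. In this copy
the new vertex is `[]` and a vertex `u` of the old tree becomes `false :: u`. -/
def extendTree (T : Finset Vertex) : Finset Vertex :=
  insert [] (T.map ⟨List.cons false, List.cons_injective⟩)

/-- Extension of a configuration on a finite rooted tree by height `1` at the new vertex. -/
def extendConfig (η : Config) : Config
  | [] => 1
  | false :: u => η u
  | true :: _ => 0

/-- Strongly allowed configurations: allowed, and without forbidden subconfiguration after a
vertex of height `1` has been attached to the root. -/
def stronglyAllowed (T : Finset Vertex) : Set Config :=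
  {η ∈ recurrent T | ¬ HasFSC (extendTree T) (extendConfig η)}

/-- Weakly allowed configurations: allowed, but not strongly allowed. -/
def weaklyAllowed (T : Finset Vertex) : Set Config :=
  {η ∈ recurrent T | HasFSC (extendTree T) (extendConfig η)}

/-- The characteristic ratio `x(T)`: the number of weakly allowed configurations over the number
of strongly allowed ones. -/
def charRatio (T : Finset Vertex) : ℝ :=
  ((weaklyAllowed T).ncard : ℝ) / ((stronglyAllowed T).ncard : ℝ)

/-! ### The random binary tree -/

/-- `ω u` says whether the individual `u`, if it is ever born, has two children or none. -/
abbrev Branching := Vertex → Bool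

/-- The individuals branch independently, each one with probability `p`. -/
def branchingMeasure (p : unitInterval) : Measure Branching :=
  Measure.infinitePi (fun _ : Vertex => bernoulliMeasure true false p)

instance (p : unitInterval) : IsProbabilityMeasure (branchingMeasure p) := by
  unfold branchingMeasure
  infer_instance

/-- The tree of the binary branching process: `v` belongs to it if and only if all its strict
ancestors branch. -/
def randomTree (ω : Branching) : Set Vertex :=
  {v | ∀ u : Vertex, u <+: v → u ≠ v → ω u = true}

/-- The random binary tree of `N` generations (generation `0` is the root). -/
def randomTreeUpTo (N : ℕ) (ω : Branching) : Finset Vertex :=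
  ((List.finite_length_le Bool N).subset
    (Set.inter_subset_right (s := randomTree ω) (t := {u : Vertex | u.length ≤ N}))).toFinset

/-- The law of the random binary tree conditioned on containing the vertex `v`, hence
the path from the root to `v`. -/
def conditionedMeasure (p : unitInterval) (v : Vertex) : Measure Branching :=
  cond (branchingMeasure p) {ω | v ∈ randomTree ω}

/-- The annealed absolute covariance of the heights at the root and at `v`, when
`μ T` is the sandpile measure of the tree `T`. -/
def annealedAbsCov (p : unitInterval) (μ : Set Vertex → ProbabilityMeasure Config)
    (v : Vertex) : ℝ :=
  ∫ ω, |heightCov (μ (randomTree ω)) [] v| ∂(conditionedMeasure p v)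

/-! ### The rate -/

/-- The largest eigenvalue of the matrix with rows `(γ, γ)` and `(1, 1 + γ)`. -/
def LambdaPlus (γ : ℝ) : ℝ := (2 * γ + 1 + √(4 * γ + 1)) / 2

/-- The smallest eigenvalue of the matrix with rows `(γ, γ)` and `(1, 1 + γ)`. -/
def LambdaMinus (γ : ℝ) : ℝ := (2 * γ + 1 - √(4 * γ + 1)) / 2

/-- The number `γ` with `γ⁻¹ = E((1 + x₁)⁻¹)`, where `x₁` has law `ν`. -/
def gammaOf (ν : Measure ℝ) : ℝ := (∫ x, (1 + x)⁻¹ ∂ν)⁻¹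

end TreeSandpile

end

/-!
The sums of a product observable over the strongly and over the weakly allowed configurations of a
tree are bilinear in the corresponding sums of the two branches at the root. In particular `x(T)` is
a function of the ratios of the branches; it converges along truncations, which defines `x(T)` for
an infinite tree, and the sums divided by the number of strongly allowed configurations converge
along every exhaustion of the tree. As the configuration space is compact, this gives `μ_T`.

Along the path from `o` to `v` the recursion shows that `|Cov(o, v)|` is, up to bounded factors,
`Q⁻²`, where `Q` is the sum of the entries of a product of matrices with rows `(1 + θ, θ)` and
`(1, 1)`, and `θ = (1 + x)⁻¹` for the subtrees that hang off the path. After conditioning on the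
path these subtrees are independent unconditioned random trees, so `E|Cov(o, v(n))|` is comparable
with `E Qₙ⁻²` for a product `Qₙ` of `n` independent matrices. This moment is supermultiplicative,
hence has an exponential rate, and by Jensen's inequality it is at least of the order of `l⁻²ⁿ`,
where `l` is the largest eigenvalue of the mean matrix. Since `E θ = γ⁻¹`, one has
`l² = Λ₊(γ) / Λ₋(γ)`, and `θ ≤ 2/3` gives the numerical bound.
-/

noncomputable section

namespace TreeSandpile

/-! ### Branches of a tree -/

/-- Sets of vertices that contain, with every vertex, all its ancestors: the rooted subtrees and
the empty set. -/
def PrefixClosed (T : Set Vertex) : Prop := ∀ u v : Vertex, u <+: v → v ∈ T → u ∈ T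

/-- The subtree that hangs off the child `[b]` of the root, with `[b]` relabelled as its root. -/
def branch (b : Bool) (T : Set Vertex) : Set Vertex := {u | b :: u ∈ T}

/-- `branch` for finite sets of vertices. -/
def finBranch (b : Bool) (T : Finset Vertex) : Finset Vertex :=
  T.preimage (List.cons b) List.cons_injective.injOn

@[simp] lemma mem_branch {b : Bool} {T : Set Vertex} {u : Vertex} :
    u ∈ branch b T ↔ b :: u ∈ T := Iff.rfl

@[simp] lemma mem_finBranch {b : Bool} {T : Finset Vertex} {u : Vertex} :
    u ∈ finBranch b T ↔ b :: u ∈ T := by simp [finBranch]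

lemma coe_finBranch (b : Bool) (T : Finset Vertex) :
    (finBranch b T : Set Vertex) = branch b (T : Set Vertex) := by
  ext u; simp

protected lemma PrefixClosed.branch {T : Set Vertex} (h : PrefixClosed T) (b : Bool) :
    PrefixClosed (branch b T) := fun u v huv hv =>
  h (b :: u) (b :: v) (by simpa using huv) hv

protected lemma PrefixClosed.finBranch {T : Finset Vertex} (h : PrefixClosed (T : Set Vertex))
    (b : Bool) : PrefixClosed (finBranch b T : Set Vertex) := by
  rw [coe_finBranch]; exact h.branch b

lemma PrefixClosed.eq_empty {T : Set Vertex} (h : PrefixClosed T) (h0 : [] ∉ T) : T = ∅ :=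
  Set.eq_empty_of_forall_notMem fun v hv => h0 (h [] v List.nil_prefix hv)

/-- The set of vertices with the root and the prescribed branches `S false` and `S true`. -/
def graft (S : Bool → Finset Vertex) : Finset Vertex :=
  insert [] (Finset.univ.biUnion fun b => (S b).map ⟨List.cons b, List.cons_injective⟩)

@[simp] lemma nil_mem_graft (S : Bool → Finset Vertex) : [] ∈ graft S := by simp [graft]

@[simp] lemma cons_mem_graft {S : Bool → Finset Vertex} {b : Bool} {u : Vertex} :
    b :: u ∈ graft S ↔ u ∈ S b := by cases b <;> simp [graft]

@[simp] lemma finBranch_graft (S : Bool → Finset Vertex) (b : Bool) :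
    finBranch b (graft S) = S b := by
  ext u; simp

lemma graft_finBranch {T : Finset Vertex} (h0 : [] ∈ T) : graft (fun b => finBranch b T) = T := by
  ext (_ | ⟨b, u⟩) <;> simp [h0]

@[to_additive]
lemma prod_graft {M : Type*} [CommMonoid M] (S : Bool → Finset Vertex) (g : Vertex → M) :
    ∏ u ∈ graft S, g u = g [] * ∏ b, ∏ u ∈ S b, g (b :: u) := by
  rw [graft, Finset.prod_insert (by simp), Finset.prod_biUnion]
  · simp
  · intro a _ b _ hab
    simp only [Function.onFun, Finset.disjoint_left, Finset.mem_map, Function.Embedding.coeFn_mk]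
    rintro _ ⟨u, -, rfl⟩ ⟨w, -, hw⟩
    exact hab (List.cons_eq_cons.1 hw).1.symm

@[to_additive]
lemma prod_eq_mul_prod_finBranch {M : Type*} [CommMonoid M] (T : Finset Vertex) (g : Vertex → M) :
    ∏ u ∈ T, g u = (if [] ∈ T then g [] else 1) * ∏ b, ∏ u ∈ finBranch b T, g (b :: u) := by
  have hgraft := prod_graft (fun b => finBranch b T) g
  split_ifs with h0
  · rwa [graft_finBranch h0] at hgraft
  · have herase : (graft fun b => finBranch b T).erase [] = T := by
      ext (_ | ⟨b, u⟩) <;> simp [h0]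
    have hprod := prod_graft (fun b => finBranch b T) (fun u => if u = [] then 1 else g u)
    rw [← Finset.mul_prod_erase _ _ (nil_mem_graft _), herase] at hprod
    simp only [if_true, one_mul, reduceCtorEq, if_false] at hprod
    rw [one_mul, ← hprod]
    exact Finset.prod_congr rfl fun u hu => by rw [if_neg (ne_of_mem_of_not_mem hu h0)]

lemma card_finBranch_lt {T : Finset Vertex} (h0 : [] ∈ T) (b : Bool) :
    (finBranch b T).card < T.card := by
  have h := sum_eq_add_sum_finBranch T fun _ => 1
  simp only [Finset.sum_const, smul_eq_mul, mul_one, h0, if_true, Fintype.sum_bool] at h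
  cases b <;> omega

lemma PrefixClosed.finset_induction {P : Finset Vertex → Prop} (hempty : P ∅)
    (hnode : ∀ T : Finset Vertex, [] ∈ T → (∀ b, P (finBranch b T)) → P T)
    (T : Finset Vertex) (hT : PrefixClosed (T : Set Vertex)) : P T := by
  induction hn : T.card using Nat.strong_induction_on generalizing T with
  | _ n ih =>
    by_cases h0 : [] ∈ T
    · exact hnode T h0 fun b => ih _ (hn ▸ card_finBranch_lt h0 b) _ (hT.finBranch b) rfl
    · rw [Finset.coe_eq_empty.1 (hT.eq_empty (by simpa using h0))]
      exact hempty

/-! ### Forbidden subconfigurations -/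

lemma binaryTree_adj_nil_cons {b : Bool} {w : Vertex} : binaryTree.Adj [] (b :: w) ↔ w = [] := by
  cases b <;> simp [binaryTree]

lemma binaryTree_adj_cons_nil {b : Bool} {u : Vertex} : binaryTree.Adj (b :: u) [] ↔ u = [] := by
  rw [binaryTree.adj_comm, binaryTree_adj_nil_cons]

lemma binaryTree_adj_cons_cons {a b : Bool} {u w : Vertex} :
    binaryTree.Adj (a :: u) (b :: w) ↔ a = b ∧ binaryTree.Adj u w := by
  simp only [binaryTree, List.cons_append, List.cons_eq_cons]
  grind

open Classical in
lemma numNeighbors_eq_sum (S : Finset Vertex) (u : Vertex) :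
    numNeighbors S u = ∑ w ∈ S, if binaryTree.Adj u w then 1 else 0 := by
  rw [Finset.sum_boole, numNeighbors, ← Set.ncard_coe_finset, Finset.coe_filter, Nat.cast_id]
  simp [Set.inter_def]

lemma numNeighbors_nil (S : Finset Vertex) :
    numNeighbors S [] = ∑ b, if [b] ∈ S then 1 else 0 := by
  simp [numNeighbors_eq_sum, sum_eq_add_sum_finBranch S, binaryTree_adj_nil_cons]

lemma numNeighbors_cons (S : Finset Vertex) (b : Bool) (u : Vertex) :
    numNeighbors S (b :: u) =
      numNeighbors (finBranch b S) u + if u = [] then (if [] ∈ S then 1 else 0) else 0 := by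
  classical
  simp only [numNeighbors_eq_sum, sum_eq_add_sum_finBranch S, binaryTree_adj_cons_nil,
    binaryTree_adj_cons_cons]
  cases b <;> simp [← ite_and, and_comm, add_comm]

/-- The configuration on the subtree that hangs off the child `[b]` of the root. -/
def tailConfig (b : Bool) (η : Config) : Config := fun u => η (b :: u)

/-- `η` restricted to `S` is forbidden when the root has `c` further neighbours in addition to
those in `S`. -/
def IsForbiddenOn (c : ℕ) (S : Finset Vertex) (η : Config) : Prop :=
  ∀ u ∈ S, (η u : ℕ) ≤ numNeighbors S u + if u = [] then c else 0

/-- `η` contains a forbidden subconfiguration in `T` when the root of `T` has `c` further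
neighbours, whose heights are so low that they may always be included. -/
def HasFSCAt (c : ℕ) (T : Finset Vertex) (η : Config) : Prop :=
  ∃ S ⊆ T, S.Nonempty ∧ IsForbiddenOn c S η

lemma hasFSCAt_zero {T : Finset Vertex} {η : Config} : HasFSCAt 0 T η ↔ HasFSC T η := by
  simp [HasFSCAt, IsForbiddenOn, HasFSC]

lemma HasFSCAt.mono {c d : ℕ} (hcd : c ≤ d) {T : Finset Vertex} {η : Config}
    (h : HasFSCAt c T η) : HasFSCAt d T η := by
  obtain ⟨S, hS, hne, h⟩ := h
  refine ⟨S, hS, hne, fun u hu => (h u hu).trans ?_⟩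
  split_ifs <;> omega

lemma not_hasFSCAt_empty (c : ℕ) (η : Config) : ¬ HasFSCAt c ∅ η := by
  rintro ⟨S, hS, hne, -⟩
  exact hne.ne_empty (Finset.subset_empty.1 hS)

lemma isForbiddenOn_iff {c : ℕ} {S : Finset Vertex} {η : Config} :
    IsForbiddenOn c S η ↔
      ([] ∈ S → (η [] : ℕ) ≤ c + ∑ b, if [b] ∈ S then 1 else 0) ∧
      ∀ b, IsForbiddenOn (if [] ∈ S then 1 else 0) (finBranch b S) (tailConfig b η) := by
  constructor
  · intro h
    refine ⟨fun h0 => ?_, fun b u hu => ?_⟩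
    · simpa [numNeighbors_nil, add_comm] using h [] h0
    · simpa [numNeighbors_cons, tailConfig] using h (b :: u) (by simpa using hu)
  · rintro ⟨h0, h⟩ (_ | ⟨b, u⟩) hu
    · simpa [numNeighbors_nil, add_comm] using h0 hu
    · simpa [numNeighbors_cons, tailConfig] using h b u (by simpa using hu)

lemma HasFSCAt.of_finBranch {T : Finset Vertex} {η : Config} {b : Bool}
    (h : HasFSCAt 0 (finBranch b T) (tailConfig b η)) (c : ℕ) : HasFSCAt c T η := by
  obtain ⟨S, hS, hne, h⟩ := h
  have hmem (a : Bool) (u : Vertex) :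
      a :: u ∈ S.map ⟨List.cons b, List.cons_injective⟩ ↔ b = a ∧ u ∈ S := by
    simp only [Finset.mem_map, Function.Embedding.coeFn_mk, List.cons_eq_cons]
    grind
  refine ⟨S.map ⟨List.cons b, List.cons_injective⟩, fun u hu => ?_, hne.map, ?_⟩
  · obtain ⟨w, hw, rfl⟩ := Finset.mem_map.1 hu
    exact mem_finBranch.1 (hS hw)
  · refine isForbiddenOn_iff.2 ⟨by simp, fun a => ?_⟩
    by_cases hab : b = a
    · subst hab
      convert h using 1
      · simp
      · ext u; simp
    · intro u hu
      simp [hmem, hab] at hu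

lemma exists_isForbiddenOn_one {T : Finset Vertex} {η : Config} (h : ¬ HasFSCAt 0 T η) :
    ∃ R ⊆ T, IsForbiddenOn 1 R η ∧ (HasFSCAt 1 T η → [] ∈ R) := by
  by_cases h1 : HasFSCAt 1 T η
  · obtain ⟨R, hR, hne, hforb⟩ := h1
    refine ⟨R, hR, hforb, fun _ => ?_⟩
    by_contra h0
    refine h ⟨R, hR, hne, fun u hu => ?_⟩
    simpa [ne_of_mem_of_not_mem hu h0] using hforb u hu
  · exact ⟨∅, by simp, by simp [IsForbiddenOn], fun h => absurd h h1⟩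

open Classical in
lemma HasFSCAt.of_le {c : ℕ} {T : Finset Vertex} {η : Config} (hT : [] ∈ T)
    (h : (η [] : ℕ) ≤ c + ∑ b, if HasFSCAt 1 (finBranch b T) (tailConfig b η) then 1 else 0) :
    HasFSCAt c T η := by
  by_cases hbranch : ∃ b, HasFSCAt 0 (finBranch b T) (tailConfig b η)
  · obtain ⟨b, hb⟩ := hbranch
    exact hb.of_finBranch c
  push Not at hbranch
  choose R hRT hR hR0 using fun b => exists_isForbiddenOn_one (hbranch b)
  refine ⟨graft R, ?_, ⟨[], by simp⟩, isForbiddenOn_iff.2 ⟨fun _ => h.trans ?_, by simpa using hR⟩⟩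
  · rintro (_ | ⟨b, u⟩) hu
    · exact hT
    · exact mem_finBranch.1 (hRT b (cons_mem_graft.1 hu))
  · gcongr with b
    split_ifs with h1 h2 <;> norm_num
    exact h2 (cons_mem_graft.2 (hR0 b h1))

open Classical in
/-- Burning the tree from the root: the only information about the branches that matters is
whether they are forbidden, weakly allowed or strongly allowed. -/
lemma hasFSCAt_iff {c : ℕ} {T : Finset Vertex} {η : Config} (hT : [] ∈ T) :
    HasFSCAt c T η ↔ (∃ b, HasFSCAt 0 (finBranch b T) (tailConfig b η)) ∨
      (η [] : ℕ) ≤ c + ∑ b, if HasFSCAt 1 (finBranch b T) (tailConfig b η) then 1 else 0 := by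
  refine ⟨?_, fun h => h.elim (fun ⟨b, hb⟩ => hb.of_finBranch c) (HasFSCAt.of_le hT)⟩
  rintro ⟨S, hS, ⟨w, hw⟩, hforb⟩
  obtain ⟨hroot, hbranch⟩ := isForbiddenOn_iff.1 hforb
  have hsub (b : Bool) : finBranch b S ⊆ finBranch b T := fun u hu =>
    mem_finBranch.2 (hS (mem_finBranch.1 hu))
  by_cases h0 : [] ∈ S
  · simp only [h0, if_true] at hbranch
    refine Or.inr ((hroot h0).trans ?_)
    gcongr with b
    split_ifs with h1 h2 <;> norm_num
    exact h2 ⟨_, hsub b, ⟨[], by simpa using h1⟩, hbranch b⟩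
  · simp only [h0, if_false] at hbranch
    rcases w with _ | ⟨b, w⟩
    · exact absurd hw h0
    · exact Or.inl ⟨b, _, hsub b, ⟨w, by simpa using hw⟩, hbranch b⟩

lemma hasFSC_extend_iff {T : Finset Vertex} {η : Config} :
    HasFSC (extendTree T) (extendConfig η) ↔ HasFSCAt 1 T η := by
  classical
  have hfalse : finBranch false (extendTree T) = T := by ext u; simp [extendTree]
  have htrue : finBranch true (extendTree T) = ∅ := by ext u; simp [extendTree]
  have htail : tailConfig false (extendConfig η) = η := by ext u; simp [tailConfig, extendConfig]
  have hroot : ((extendConfig η [] : Fin 4) : ℕ) = 1 := rfl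
  rw [← hasFSCAt_zero, hasFSCAt_iff (by simp [extendTree]), hroot]
  simp only [Bool.exists_bool, Fintype.sum_bool, hfalse, htrue, htail, not_hasFSCAt_empty, if_false,
    or_false, zero_add]
  refine ⟨fun h => ?_, fun h => Or.inr (by simp [h])⟩
  rcases h with h | h
  · exact h.mono zero_le_one
  · by_contra h1
    simp [h1] at h

lemma mem_stronglyAllowed {T : Finset Vertex} {η : Config} :
    η ∈ stronglyAllowed T ↔ IsStable T η ∧ ¬ HasFSCAt 1 T η := by
  simp only [stronglyAllowed, recurrent, hasFSC_extend_iff, Set.mem_ofPred_eq]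
  rw [← hasFSCAt_zero]
  exact ⟨fun h => ⟨h.1.1, h.2⟩, fun h => ⟨⟨h.1, fun h' => h.2 (h'.mono zero_le_one)⟩, h.2⟩⟩

lemma mem_weaklyAllowed {T : Finset Vertex} {η : Config} :
    η ∈ weaklyAllowed T ↔ IsStable T η ∧ ¬ HasFSCAt 0 T η ∧ HasFSCAt 1 T η := by
  simp only [weaklyAllowed, recurrent, hasFSC_extend_iff, hasFSCAt_zero, Set.mem_ofPred_eq,
    and_assoc]

/-! ### Partition sums over allowed configurations -/

lemma finite_stable (T : Finset Vertex) : {η | IsStable T η}.Finite := by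
  refine Set.Finite.of_injOn (f := fun η (u : T) => η u) (Set.mapsTo_univ _ _) ?_ Set.finite_univ
  intro η hη ξ hξ h
  ext1 u
  by_cases hu : u ∈ T
  · exact congrFun h ⟨u, hu⟩
  · rw [not_not.1 fun h0 => hu ((hη u).2 h0), not_not.1 fun h0 => hu ((hξ u).2 h0)]

/-- The finite set of the stable configurations on `T`. -/
def stableConfigs (T : Finset Vertex) : Finset Config := (finite_stable T).toFinset

@[simp] lemma mem_stableConfigs {T : Finset Vertex} {η : Config} :
    η ∈ stableConfigs T ↔ IsStable T η := by simp [stableConfigs]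

lemma stableConfigs_empty : stableConfigs ∅ = {0} := by
  ext η
  simp [IsStable, funext_iff]

/-- The configuration with height `h` at the root and the configurations `η₀`, `η₁` on the
branches of the root. -/
def joinConfig (h : Fin 4) (η₀ η₁ : Config) : Config
  | [] => h
  | false :: u => η₀ u
  | true :: u => η₁ u

@[simp] lemma tailConfig_false_joinConfig (h : Fin 4) (η₀ η₁ : Config) :
    tailConfig false (joinConfig h η₀ η₁) = η₀ := rfl

@[simp] lemma tailConfig_true_joinConfig (h : Fin 4) (η₀ η₁ : Config) :
    tailConfig true (joinConfig h η₀ η₁) = η₁ := rfl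

lemma joinConfig_tailConfig (η : Config) :
    joinConfig (η []) (tailConfig false η) (tailConfig true η) = η := by
  ext1 u
  rcases u with _ | ⟨_ | _, u⟩ <;> rfl

lemma isStable_iff {T : Finset Vertex} (hT : [] ∈ T) {η : Config} :
    IsStable T η ↔ η [] ≠ 0 ∧ ∀ b, IsStable (finBranch b T) (tailConfig b η) := by
  refine ⟨fun h => ⟨(h []).1 hT, fun b u => mem_finBranch.trans (h (b :: u))⟩, ?_⟩
  rintro ⟨h0, h⟩ (_ | ⟨b, u⟩)
  · simp [hT, h0]
  · exact mem_finBranch.symm.trans (h b u)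

lemma sum_stableConfigs {M : Type*} [AddCommMonoid M] {T : Finset Vertex} (hT : [] ∈ T)
    (F : Config → M) :
    ∑ η ∈ stableConfigs T, F η = ∑ η₀ ∈ stableConfigs (finBranch false T),
      ∑ η₁ ∈ stableConfigs (finBranch true T), ∑ h ∈ {1, 2, 3}, F (joinConfig h η₀ η₁) := by
  have hne (h : Fin 4) : h ∈ ({1, 2, 3} : Finset (Fin 4)) ↔ h ≠ 0 := by revert h; decide
  simp only [← Finset.sum_product']
  symm
  refine Finset.sum_bij' (fun x _ => joinConfig x.2.2 x.1 x.2.1)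
    (fun η _ => (tailConfig false η, tailConfig true η, η [])) ?_ ?_ (fun _ _ => rfl)
    (fun η _ => joinConfig_tailConfig η) (fun _ _ => rfl)
  · rintro ⟨η₀, η₁, h⟩ hx
    simp only [Finset.mem_product, mem_stableConfigs, hne] at hx
    exact mem_stableConfigs.2 ((isStable_iff hT).2
      ⟨hx.2.2, fun b => by cases b; exacts [hx.1, hx.2.1]⟩)
  · intro η hη
    obtain ⟨h0, h⟩ := (isStable_iff hT).1 (mem_stableConfigs.1 hη)
    simpa only [Finset.mem_product, mem_stableConfigs, hne] using ⟨h false, h true, h0⟩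

/-- Total weights of the strongly and of the weakly allowed configurations of a tree, computed
from those of the branches of the root, `p` and `q`, when height `h` at the root has weight `φ h`.
If `k` of the branches are weakly allowed and the others strongly, then the configuration is
strongly allowed for `h ≥ k + 2` and weakly allowed for `h = k + 1`. -/
def nodeSums (φ : Fin 4 → ℝ) (p q : ℝ × ℝ) : ℝ × ℝ :=
  (p.1 * q.1 * (φ 2 + φ 3) + (p.1 * q.2 + p.2 * q.1) * φ 3,
    p.1 * q.1 * φ 1 + (p.1 * q.2 + p.2 * q.1) * φ 2 + p.2 * q.2 * φ 3)

lemma nodeSums_comm (φ : Fin 4 → ℝ) (p q : ℝ × ℝ) : nodeSums φ p q = nodeSums φ q p := by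
  ext <;> simp only [nodeSums] <;> ring

lemma nodeSums_smul_smul (φ : Fin 4 → ℝ) (a b : ℝ) (p q : ℝ × ℝ) :
    nodeSums φ (a • p) (b • q) = (a * b) • nodeSums φ p q := by
  ext <;> simp only [nodeSums, Prod.smul_fst, Prod.smul_snd, smul_eq_mul] <;> ring

lemma nodeSums_sum_sum {ι κ : Type*} (φ : Fin 4 → ℝ) (s : Finset ι) (t : Finset κ)
    (p : ι → ℝ × ℝ) (q : κ → ℝ × ℝ) :
    nodeSums φ (∑ i ∈ s, p i) (∑ j ∈ t, q j) = ∑ i ∈ s, ∑ j ∈ t, nodeSums φ (p i) (q j) := by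
  ext <;> simp only [nodeSums, Prod.fst_sum, Prod.snd_sum, Finset.sum_mul_sum, ← Finset.sum_mul,
    Finset.sum_add_distrib]

open Classical in
/-- The class of `η` on `T` as a pair of indicators: `(1, 0)` if `η` is strongly allowed, `(0, 1)`
if it is weakly allowed, and `(0, 0)` if it is not allowed. -/
def allowedClass (T : Finset Vertex) (η : Config) : ℝ × ℝ :=
  (if ¬ HasFSCAt 1 T η then 1 else 0, if HasFSCAt 1 T η ∧ ¬ HasFSCAt 0 T η then 1 else 0)

lemma allowedClass_empty (η : Config) : allowedClass ∅ η = (1, 0) := by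
  simp [allowedClass, not_hasFSCAt_empty]

lemma sum_smul_allowedClass_joinConfig {T : Finset Vertex} (hT : [] ∈ T) (φ : Fin 4 → ℝ)
    (η₀ η₁ : Config) :
    ∑ h ∈ {1, 2, 3}, φ h • allowedClass T (joinConfig h η₀ η₁) =
      nodeSums φ (allowedClass (finBranch false T) η₀) (allowedClass (finBranch true T) η₁) := by
  classical
  have hmono₀ : HasFSCAt 0 (finBranch false T) η₀ → HasFSCAt 1 (finBranch false T) η₀ :=
    HasFSCAt.mono zero_le_one
  have hmono₁ : HasFSCAt 0 (finBranch true T) η₁ → HasFSCAt 1 (finBranch true T) η₁ :=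
    HasFSCAt.mono zero_le_one
  have h1 : ((1 : Fin 4) : ℕ) = 1 := rfl
  have h2 : ((2 : Fin 4) : ℕ) = 2 := rfl
  have h3 : ((3 : Fin 4) : ℕ) = 3 := rfl
  rw [Finset.sum_insert (by decide), Finset.sum_insert (by decide), Finset.sum_singleton]
  simp only [allowedClass, nodeSums, hasFSCAt_iff hT, Bool.exists_bool, Fintype.sum_bool,
    tailConfig_false_joinConfig, tailConfig_true_joinConfig, joinConfig, h1, h2, h3]
  by_cases hs₀ : HasFSCAt 1 (finBranch false T) η₀ <;>
  by_cases hs₁ : HasFSCAt 1 (finBranch true T) η₁ <;>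
  by_cases hw₀ : HasFSCAt 0 (finBranch false T) η₀ <;>
  by_cases hw₁ : HasFSCAt 0 (finBranch true T) η₁ <;>
  simp_all [add_comm]

/-- Restriction to a branch of a family of functions indexed by the vertices. -/
def shift (b : Bool) (f : Vertex → Fin 4 → ℝ) : Vertex → Fin 4 → ℝ := fun u => f (b :: u)

/-- The product observable `∏_{|u| < n} f u (η u)`. -/
def obs : ℕ → (Vertex → Fin 4 → ℝ) → Config → ℝ
  | 0, _, _ => 1
  | n + 1, f, η => f [] (η []) * obs n (shift false f) (tailConfig false η) *
      obs n (shift true f) (tailConfig true η)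

@[simp] lemma obs_one (n : ℕ) (η : Config) : obs n 1 η = 1 := by
  induction n generalizing η with
  | zero => rfl
  | succ n ih => simp [obs, show ∀ b, shift b 1 = 1 from fun _ => rfl, ih]

/-- The sums of the product observable over the strongly and over the weakly allowed
configurations. -/
def partitionSums (n : ℕ) (f : Vertex → Fin 4 → ℝ) (T : Finset Vertex) : ℝ × ℝ :=
  ∑ η ∈ stableConfigs T, obs n f η • allowedClass T η

lemma partitionSums_empty (n : ℕ) (f : Vertex → Fin 4 → ℝ) :
    partitionSums n f ∅ = (obs n f 0, 0) := by
  simp [partitionSums, stableConfigs_empty, allowedClass_empty]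

lemma partitionSums_succ {T : Finset Vertex} (hT : [] ∈ T) (n : ℕ) (f : Vertex → Fin 4 → ℝ) :
    partitionSums (n + 1) f T =
      nodeSums (f []) (partitionSums n (shift false f) (finBranch false T))
        (partitionSums n (shift true f) (finBranch true T)) := by
  simp only [partitionSums, sum_stableConfigs hT, nodeSums_sum_sum, nodeSums_smul_smul,
    ← sum_smul_allowedClass_joinConfig hT, Finset.smul_sum, smul_smul]
  refine Finset.sum_congr rfl fun η₀ _ => Finset.sum_congr rfl fun η₁ _ =>
    Finset.sum_congr rfl fun h _ => ?_
  congr 1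
  simp only [obs, tailConfig_false_joinConfig, tailConfig_true_joinConfig, joinConfig]
  ring

/-- The numbers of strongly and of weakly allowed configurations. -/
def allowedCounts (T : Finset Vertex) : ℝ × ℝ := ∑ η ∈ stableConfigs T, allowedClass T η

lemma partitionSums_zero (f : Vertex → Fin 4 → ℝ) (T : Finset Vertex) :
    partitionSums 0 f T = allowedCounts T := by
  simp [partitionSums, allowedCounts, obs]

lemma allowedCounts_empty : allowedCounts ∅ = (1, 0) := by
  rw [← partitionSums_zero 1, partitionSums_empty, obs]

lemma allowedCounts_node {T : Finset Vertex} (hT : [] ∈ T) :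
    allowedCounts T =
      nodeSums 1 (allowedCounts (finBranch false T)) (allowedCounts (finBranch true T)) := by
  have h : partitionSums 1 1 T = allowedCounts T := by simp [partitionSums, allowedCounts]
  rw [← h, partitionSums_succ hT, partitionSums_zero, partitionSums_zero]
  rfl

lemma allowedCounts_snd_nonneg (T : Finset Vertex) : 0 ≤ (allowedCounts T).2 := by
  rw [allowedCounts, Prod.snd_sum]
  refine Finset.sum_nonneg fun η _ => ?_
  simp only [allowedClass]
  positivity

lemma allowedCounts_fst_pos {T : Finset Vertex} (hT : PrefixClosed (T : Set Vertex)) :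
    0 < (allowedCounts T).1 := by
  refine PrefixClosed.finset_induction (P := fun T => 0 < (allowedCounts T).1) ?_ ?_ T hT
  · simp [allowedCounts_empty]
  · intro T h0 ih
    have h (b : Bool) : 0 ≤ (allowedCounts (finBranch b T)).2 := allowedCounts_snd_nonneg _
    have hf := ih false
    have ht := ih true
    have hf' := h false
    have ht' := h true
    rw [allowedCounts_node h0, nodeSums]
    simp only [Pi.one_apply]
    positivity

lemma charRatio_eq (T : Finset Vertex) :
    charRatio T = (allowedCounts T).2 / (allowedCounts T).1 := by
  classical
  have hstrong : stronglyAllowed T =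
      ((stableConfigs T).filter (fun η => ¬ HasFSCAt 1 T η) : Finset Config) := by
    ext η; simp [mem_stronglyAllowed]
  have hweak : weaklyAllowed T =
      ((stableConfigs T).filter (fun η => HasFSCAt 1 T η ∧ ¬ HasFSCAt 0 T η) : Finset Config) := by
    ext η; simp [mem_weaklyAllowed, and_comm]
  rw [charRatio, hstrong, hweak, Set.ncard_coe_finset, Set.ncard_coe_finset]
  simp only [allowedCounts, allowedClass, Prod.fst_sum, Prod.snd_sum, Finset.sum_boole]

lemma integral_uniformOn_finset {α : Type*} [MeasurableSpace α] [MeasurableSingletonClass α]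
    (s : Finset α) (g : α → ℝ) :
    ∫ x, g x ∂(uniformOn (s : Set α)) = (∑ x ∈ s, g x) / s.card := by
  have hintegrable : IntegrableOn g (s : Set α) Measure.count := by
    rw [← Set.biUnion_of_singleton (s : Set α)]
    exact integrableOn_finset_iUnion.2 fun x _ => integrableOn_singleton (by simp) (by simp)
  rw [uniformOn, ProbabilityTheory.cond, integral_smul_measure, setIntegral_finset _ hintegrable,
    Measure.count_apply_finset, ENNReal.toReal_inv, ENNReal.toReal_natCast, smul_eq_mul,
    div_eq_inv_mul]
  simp [measureReal_def]

lemma integral_obs_finiteSandpileMeasure (n : ℕ) (f : Vertex → Fin 4 → ℝ) (T : Finset Vertex) :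
    ∫ η, obs n f η ∂(finiteSandpileMeasure T : Measure Config) =
      ((partitionSums n f T).1 + (partitionSums n f T).2) /
        ((allowedCounts T).1 + (allowedCounts T).2) := by
  classical
  have hrec : recurrent T =
      ((stableConfigs T).filter (fun η => ¬ HasFSCAt 0 T η) : Finset Config) := by
    ext η
    simp [hasFSCAt_zero, recurrent]
  have hclass (η : Config) : (if ¬ HasFSCAt 0 T η then 1 else 0) =
      (allowedClass T η).1 + (allowedClass T η).2 := by
    have := @HasFSCAt.mono 0 1 zero_le_one T η
    by_cases hw : HasFSCAt 0 T η <;> by_cases hs : HasFSCAt 1 T η <;> simp_all [allowedClass]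
  have hsum (g : Config → ℝ) :
      ∑ η ∈ stableConfigs T with ¬ HasFSCAt 0 T η, g η = (∑ η ∈ stableConfigs T,
        g η • allowedClass T η).1 + (∑ η ∈ stableConfigs T, g η • allowedClass T η).2 := by
    simp only [Prod.fst_sum, Prod.snd_sum, ← Finset.sum_add_distrib, Prod.smul_fst, Prod.smul_snd,
      smul_eq_mul, ← mul_add, ← hclass, mul_ite, mul_one, mul_zero, Finset.sum_filter]
  have hcard := hsum 1
  simp only [Pi.one_apply, one_smul, Finset.sum_const, nsmul_eq_mul, mul_one] at hcard
  change ∫ η, obs n f η ∂(uniformOn (recurrent T)) = _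
  rw [hrec, integral_uniformOn_finset, hsum, hcard]
  rfl

/-! ### The characteristic ratio of infinite trees -/

/-- The characteristic ratio of a tree in terms of those of the branches of its root. -/
def ratioStep (x y : ℝ) : ℝ := ((1 + x)⁻¹ + (1 + y)⁻¹)⁻¹

lemma ratioStep_eq_div {x y : ℝ} (hx : 0 ≤ x) (hy : 0 ≤ y) :
    ratioStep x y = (1 + x) * (1 + y) / (2 + x + y) := by
  rw [ratioStep]
  field_simp
  ring

lemma ratioStep_le_ratioStep {a b c d : ℝ} (ha : 0 ≤ a) (hc : 0 ≤ c) (hab : a ≤ b) (hcd : c ≤ d) :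
    ratioStep a c ≤ ratioStep b d := by
  have hb := ha.trans hab
  have hd := hc.trans hcd
  unfold ratioStep
  gcongr

lemma ratioStep_le_one {x y : ℝ} (hx : 0 ≤ x) (hy : 0 ≤ y) (hx1 : x ≤ 1) (hy1 : y ≤ 1) :
    ratioStep x y ≤ 1 :=
  (ratioStep_le_ratioStep hx hy hx1 hy1).trans_eq (by norm_num [ratioStep])

lemma half_le_ratioStep {x y : ℝ} (hx : 0 ≤ x) (hy : 0 ≤ y) : 1 / 2 ≤ ratioStep x y :=
  (ratioStep_le_ratioStep le_rfl le_rfl hx hy).trans_eq' (by norm_num [ratioStep])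

lemma continuousAt_ratioStep {x y : ℝ} (hx : 0 ≤ x) (hy : 0 ≤ y) :
    ContinuousAt (fun q : ℝ × ℝ => ratioStep q.1 q.2) (x, y) := by
  have hx' : 1 + x ≠ 0 := by positivity
  have hy' : 1 + y ≠ 0 := by positivity
  have hsum : (1 + x)⁻¹ + (1 + y)⁻¹ ≠ 0 := by positivity
  unfold ratioStep
  fun_prop (disch := assumption)

lemma charRatio_empty : charRatio ∅ = 0 := by simp [charRatio_eq, allowedCounts_empty]

lemma charRatio_nonneg (T : Finset Vertex) : 0 ≤ charRatio T := by
  unfold charRatio; positivity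

lemma allowedCounts_snd_eq {T : Finset Vertex} (hT : PrefixClosed (T : Set Vertex)) :
    (allowedCounts T).2 = charRatio T * (allowedCounts T).1 := by
  rw [charRatio_eq, div_mul_cancel₀ _ (allowedCounts_fst_pos hT).ne']

lemma allowedCounts_fst_node {T : Finset Vertex} (hT : PrefixClosed (T : Set Vertex))
    (h0 : [] ∈ T) : (allowedCounts T).1 =
      (2 + charRatio (finBranch false T) + charRatio (finBranch true T)) *
        ((allowedCounts (finBranch false T)).1 * (allowedCounts (finBranch true T)).1) := by
  rw [allowedCounts_node h0, nodeSums, allowedCounts_snd_eq (hT.finBranch false),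
    allowedCounts_snd_eq (hT.finBranch true)]
  simp only [Pi.one_apply]
  ring

lemma charRatio_node {T : Finset Vertex} (hT : PrefixClosed (T : Set Vertex)) (h0 : [] ∈ T) :
    charRatio T = ratioStep (charRatio (finBranch false T)) (charRatio (finBranch true T)) := by
  have hx := charRatio_nonneg (finBranch false T)
  have hy := charRatio_nonneg (finBranch true T)
  have hf := allowedCounts_fst_pos (hT.finBranch false)
  have ht := allowedCounts_fst_pos (hT.finBranch true)
  rw [ratioStep_eq_div hx hy, charRatio_eq T, allowedCounts_fst_node hT h0, allowedCounts_node h0,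
    nodeSums, allowedCounts_snd_eq (hT.finBranch false), allowedCounts_snd_eq (hT.finBranch true),
    div_eq_div_iff (by positivity) (by positivity)]
  simp only [Pi.one_apply]
  ring

open Classical in
/-- The characteristic ratio of the vertices `u` of the tree `T` with `u.length < n`. -/
def truncatedRatio : ℕ → Set Vertex → ℝ
  | 0, _ => 0
  | n + 1, T =>
    if [] ∈ T then
      ratioStep (truncatedRatio n (branch false T)) (truncatedRatio n (branch true T))
    else 0

lemma truncatedRatio_mem_Icc (n : ℕ) (T : Set Vertex) : truncatedRatio n T ∈ Set.Icc 0 1 := by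
  induction n generalizing T with
  | zero => simp [truncatedRatio]
  | succ n ih =>
    obtain ⟨hf, hf1⟩ := ih (branch false T)
    obtain ⟨ht, ht1⟩ := ih (branch true T)
    rw [truncatedRatio]
    split_ifs
    · exact ⟨by linarith [half_le_ratioStep hf ht], ratioStep_le_one hf ht hf1 ht1⟩
    · simp

lemma truncatedRatio_nonneg (n : ℕ) (T : Set Vertex) : 0 ≤ truncatedRatio n T :=
  (truncatedRatio_mem_Icc n T).1

lemma truncatedRatio_le_one (n : ℕ) (T : Set Vertex) : truncatedRatio n T ≤ 1 :=
  (truncatedRatio_mem_Icc n T).2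

lemma truncatedRatio_le_of_subset {n : ℕ} {T T' : Set Vertex}
    (h : ∀ u ∈ T, u.length < n → u ∈ T') : truncatedRatio n T ≤ truncatedRatio n T' := by
  induction n generalizing T T' with
  | zero => simp [truncatedRatio]
  | succ n ih =>
    by_cases h0 : [] ∈ T
    · rw [truncatedRatio, truncatedRatio, if_pos h0, if_pos (h _ h0 (by simp))]
      refine ratioStep_le_ratioStep (truncatedRatio_nonneg _ _) (truncatedRatio_nonneg _ _)
        (ih ?_) (ih ?_) <;>
      exact fun u hu hn => h _ hu (by simpa using hn)
    · rw [truncatedRatio, if_neg h0]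
      exact truncatedRatio_nonneg (n + 1) T'

lemma truncatedRatio_monotone (T : Set Vertex) : Monotone fun n => truncatedRatio n T := by
  refine monotone_nat_of_le_succ fun n => ?_
  induction n generalizing T with
  | zero => exact truncatedRatio_nonneg _ _
  | succ n ih =>
    rw [truncatedRatio, truncatedRatio]
    split_ifs
    · exact ratioStep_le_ratioStep (truncatedRatio_nonneg _ _) (truncatedRatio_nonneg _ _) (ih _)
        (ih _)
    · exact le_rfl

lemma charRatio_eq_truncatedRatio {n : ℕ} {T : Finset Vertex}
    (hT : PrefixClosed (T : Set Vertex)) (hn : ∀ u ∈ T, u.length < n) :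
    charRatio T = truncatedRatio n T := by
  induction n generalizing T with
  | zero =>
    have hempty : T = ∅ := Finset.eq_empty_of_forall_notMem fun u hu => by simpa using hn u hu
    rw [hempty, charRatio_empty, truncatedRatio]
  | succ n ih =>
    rw [truncatedRatio]
    split_ifs with h0
    · have hbranch (b : Bool) : charRatio (finBranch b T) = truncatedRatio n (branch b T) := by
        rw [← coe_finBranch]
        exact ih (hT.finBranch b) fun u hu => by simpa using hn (b :: u) (mem_finBranch.1 hu)
      rw [charRatio_node hT (by simpa using h0), hbranch, hbranch]
    · rw [Finset.coe_eq_empty.1 (hT.eq_empty h0), charRatio_empty]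

/-- The characteristic ratio of a finite or infinite rooted tree (and `0` for the empty tree). -/
def treeRatio (T : Set Vertex) : ℝ := ⨆ n, truncatedRatio n T

lemma bddAbove_truncatedRatio (T : Set Vertex) : BddAbove (Set.range fun n => truncatedRatio n T) :=
  ⟨1, Set.forall_mem_range.2 fun n => truncatedRatio_le_one n T⟩

lemma tendsto_truncatedRatio (T : Set Vertex) :
    Tendsto (fun n => truncatedRatio n T) atTop (𝓝 (treeRatio T)) :=
  tendsto_atTop_ciSup (truncatedRatio_monotone T) (bddAbove_truncatedRatio T)

lemma truncatedRatio_le_treeRatio (n : ℕ) (T : Set Vertex) : truncatedRatio n T ≤ treeRatio T :=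
  le_ciSup (bddAbove_truncatedRatio T) n

lemma treeRatio_nonneg (T : Set Vertex) : 0 ≤ treeRatio T :=
  (truncatedRatio_nonneg 0 T).trans (truncatedRatio_le_treeRatio 0 T)

lemma treeRatio_le_one (T : Set Vertex) : treeRatio T ≤ 1 :=
  ciSup_le fun n => truncatedRatio_le_one n T

lemma treeRatio_node {T : Set Vertex} (hT : [] ∈ T) :
    treeRatio T = ratioStep (treeRatio (branch false T)) (treeRatio (branch true T)) := by
  have hlim := (continuousAt_ratioStep (treeRatio_nonneg (branch false T))
    (treeRatio_nonneg (branch true T))).tendsto.comp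
    ((tendsto_truncatedRatio (branch false T)).prodMk_nhds (tendsto_truncatedRatio (branch true T)))
  refine tendsto_nhds_unique ((tendsto_truncatedRatio T).comp (tendsto_add_atTop_nat 1))
    (hlim.congr fun n => ?_)
  simp [truncatedRatio, hT]

lemma treeRatio_of_notMem {T : Set Vertex} (hT : [] ∉ T) : treeRatio T = 0 := by
  have hzero (n : ℕ) : truncatedRatio n T = 0 := by cases n <;> simp [truncatedRatio, hT]
  simp [treeRatio, hzero]

lemma half_le_treeRatio {T : Set Vertex} (hT : [] ∈ T) : 1 / 2 ≤ treeRatio T := by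
  rw [treeRatio_node hT]
  exact half_le_ratioStep (treeRatio_nonneg _) (treeRatio_nonneg _)

/-- `(1 + x)⁻¹`, where `x` is the characteristic ratio of the tree. This is the quantity through
which the branches off the path from the root to `v` enter the covariance. -/
def theta (T : Set Vertex) : ℝ := (1 + treeRatio T)⁻¹

lemma theta_pos (T : Set Vertex) : 0 < theta T := by
  have := treeRatio_nonneg T
  unfold theta; positivity

lemma half_le_theta (T : Set Vertex) : 1 / 2 ≤ theta T := by
  have := treeRatio_nonneg T
  rw [theta, one_div]
  exact inv_anti₀ (by positivity) (by linarith [treeRatio_le_one T])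

lemma theta_le_one (T : Set Vertex) : theta T ≤ 1 :=
  inv_le_one_of_one_le₀ (by linarith [treeRatio_nonneg T])

lemma theta_le_two_thirds {T : Set Vertex} (hT : [] ∈ T) : theta T ≤ 2 / 3 := by
  rw [theta, show (2 / 3 : ℝ) = (1 + 1 / 2)⁻¹ by norm_num]
  exact inv_anti₀ (by norm_num) (by linarith [half_le_treeRatio hT])

/-! ### Existence of the sandpile measure -/

/-- The finite trees `T' i` exhaust the tree `T` along the filter `l`. -/
structure Exhausts {ι : Type*} (l : Filter ι) (T' : ι → Finset Vertex) (T : Set Vertex) :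
    Prop where
  prefixClosed : ∀ i, PrefixClosed (T' i : Set Vertex)
  subset : ∀ i, (T' i : Set Vertex) ⊆ T
  eventually_mem : ∀ u ∈ T, ∀ᶠ i in l, u ∈ T' i

protected lemma Exhausts.finBranch {ι : Type*} {l : Filter ι} {T' : ι → Finset Vertex}
    {T : Set Vertex} (h : Exhausts l T' T) (b : Bool) :
    Exhausts l (fun i => finBranch b (T' i)) (branch b T) where
  prefixClosed i := (h.prefixClosed i).finBranch b
  subset i u hu := h.subset i (by simpa using hu)
  eventually_mem u hu := (h.eventually_mem (b :: u) hu).mono fun _ hi => mem_finBranch.2 hi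

lemma Exhausts.mono {ι : Type*} {l l' : Filter ι} {T' : ι → Finset Vertex} {T : Set Vertex}
    (h : Exhausts l T' T) (hl : l' ≤ l) : Exhausts l' T' T :=
  ⟨h.prefixClosed, h.subset, fun u hu => hl (h.eventually_mem u hu)⟩

lemma charRatio_le_treeRatio {T' : Finset Vertex} {T : Set Vertex}
    (h : PrefixClosed (T' : Set Vertex)) (hT : (T' : Set Vertex) ⊆ T) :
    charRatio T' ≤ treeRatio T := by
  rw [charRatio_eq_truncatedRatio h fun u hu =>
    Nat.lt_succ_of_le (Finset.le_sup (f := List.length) hu)]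
  exact (truncatedRatio_le_of_subset fun u hu _ => hT hu).trans (truncatedRatio_le_treeRatio _ _)

lemma truncatedRatio_le_charRatio {n : ℕ} {T' : Finset Vertex} {T : Set Vertex}
    (h : PrefixClosed (T' : Set Vertex)) (hT : ∀ u ∈ T, u.length < n → u ∈ T') :
    truncatedRatio n T ≤ charRatio T' := by
  rw [charRatio_eq_truncatedRatio (n := max n (T'.sup List.length + 1)) h fun u hu =>
    lt_max_of_lt_right (Nat.lt_succ_of_le (Finset.le_sup (f := List.length) hu))]
  exact (truncatedRatio_le_of_subset hT).trans (truncatedRatio_monotone _ (le_max_left _ _))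

lemma Exhausts.tendsto_charRatio {ι : Type*} {l : Filter ι} {T' : ι → Finset Vertex}
    {T : Set Vertex} (h : Exhausts l T' T) :
    Tendsto (fun i => charRatio (T' i)) l (𝓝 (treeRatio T)) := by
  refine tendsto_order.2 ⟨fun a ha => ?_, fun a ha => Eventually.of_forall fun i =>
    (charRatio_le_treeRatio (h.prefixClosed i) (h.subset i)).trans_lt ha⟩
  obtain ⟨n, hn⟩ := ((tendsto_truncatedRatio T).eventually_const_lt ha).exists
  have hfin : (T ∩ {u : Vertex | u.length < n}).Finite :=
    (List.finite_length_lt Bool n).subset Set.inter_subset_right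
  filter_upwards [(eventually_all_finite hfin).2 fun u hu => h.eventually_mem u hu.1] with i hi
  exact hn.trans_le
    (truncatedRatio_le_charRatio (h.prefixClosed i) fun u hu hu' => hi u ⟨hu, hu'⟩)

/-- The partition sums divided by the number of strongly allowed configurations. -/
def normSums (n : ℕ) (f : Vertex → Fin 4 → ℝ) (T : Finset Vertex) : ℝ × ℝ :=
  (allowedCounts T).1⁻¹ • partitionSums n f T

lemma normSums_zero (f : Vertex → Fin 4 → ℝ) {T : Finset Vertex}
    (hT : PrefixClosed (T : Set Vertex)) : normSums 0 f T = (1, charRatio T) := by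
  rw [normSums, partitionSums_zero, charRatio_eq, div_eq_inv_mul]
  ext
  · exact inv_mul_cancel₀ (allowedCounts_fst_pos hT).ne'
  · rfl

lemma normSums_succ (n : ℕ) (f : Vertex → Fin 4 → ℝ) {T : Finset Vertex}
    (hT : PrefixClosed (T : Set Vertex)) (h0 : [] ∈ T) : normSums (n + 1) f T =
      (2 + charRatio (finBranch false T) + charRatio (finBranch true T))⁻¹ •
        nodeSums (f []) (normSums n (shift false f) (finBranch false T))
          (normSums n (shift true f) (finBranch true T)) := by
  rw [normSums, normSums, normSums, nodeSums_smul_smul, partitionSums_succ h0,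
    allowedCounts_fst_node hT h0, smul_smul, mul_inv, mul_inv]

open Classical in
/-- The limit of `normSums n f` along finite trees that exhaust `T`. -/
def limSums : ℕ → (Vertex → Fin 4 → ℝ) → Set Vertex → ℝ × ℝ
  | 0, _, T => (1, treeRatio T)
  | n + 1, f, T =>
    if [] ∈ T then
      (2 + treeRatio (branch false T) + treeRatio (branch true T))⁻¹ •
        nodeSums (f []) (limSums n (shift false f) (branch false T))
          (limSums n (shift true f) (branch true T))
    else (obs (n + 1) f 0, 0)

lemma two_add_treeRatio_pos (S T : Set Vertex) : 0 < 2 + treeRatio S + treeRatio T := by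
  linarith [treeRatio_nonneg S, treeRatio_nonneg T]

lemma continuous_nodeSums (φ : Fin 4 → ℝ) :
    Continuous fun p : (ℝ × ℝ) × ℝ × ℝ => nodeSums φ p.1 p.2 := by
  unfold nodeSums
  fun_prop

lemma Exhausts.tendsto_normSums {ι : Type*} {l : Filter ι} {T' : ι → Finset Vertex}
    {T : Set Vertex} (h : Exhausts l T' T) (n : ℕ) (f : Vertex → Fin 4 → ℝ) :
    Tendsto (fun i => normSums n f (T' i)) l (𝓝 (limSums n f T)) := by
  induction n generalizing f T T' with
  | zero =>
    simp only [limSums, normSums_zero f (h.prefixClosed _)]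
    exact tendsto_const_nhds.prodMk_nhds h.tendsto_charRatio
  | succ n ih =>
    rw [limSums]
    split_ifs with h0
    · have hratio := ((h.finBranch false).tendsto_charRatio.const_add 2).add
        (h.finBranch true).tendsto_charRatio
      have hnode := ((continuous_nodeSums (f [])).tendsto _).comp
        ((ih (h.finBranch false) (shift false f)).prodMk_nhds
          (ih (h.finBranch true) (shift true f)))
      refine ((hratio.inv₀ (two_add_treeRatio_pos _ _).ne').smul hnode).congr' ?_
      filter_upwards [h.eventually_mem [] h0] with i hi
      rw [normSums_succ n f (h.prefixClosed i) hi]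
      rfl
    · have hempty (i) : T' i = ∅ :=
        Finset.coe_eq_empty.1 ((h.prefixClosed i).eq_empty fun h' => h0 (h.subset i h'))
      simpa [hempty, normSums, partitionSums_empty, allowedCounts_empty] using tendsto_const_nhds

/-- The mean of the observable `obs n f` under the sandpile measure of `T`. -/
def limMean (n : ℕ) (f : Vertex → Fin 4 → ℝ) (T : Set Vertex) : ℝ :=
  ((limSums n f T).1 + (limSums n f T).2) / (1 + treeRatio T)

lemma Exhausts.tendsto_mean {ι : Type*} {l : Filter ι} {T' : ι → Finset Vertex}
    {T : Set Vertex} (h : Exhausts l T' T) (n : ℕ) (f : Vertex → Fin 4 → ℝ) :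
    Tendsto (fun i => ∫ η, obs n f η ∂(finiteSandpileMeasure (T' i) : Measure Config)) l
      (𝓝 (limMean n f T)) := by
  have hsums := h.tendsto_normSums n f
  have hne : 1 + treeRatio T ≠ 0 := by linarith [treeRatio_nonneg T]
  refine ((hsums.fst_nhds.add hsums.snd_nhds).div (h.tendsto_charRatio.const_add 1) hne).congr
    fun i => ?_
  have hpos := allowedCounts_fst_pos (h.prefixClosed i)
  have hratio := charRatio_nonneg (T' i)
  rw [integral_obs_finiteSandpileMeasure, allowedCounts_snd_eq (h.prefixClosed i)]
  simp only [Pi.div_apply, normSums, Prod.smul_fst, Prod.smul_snd, smul_eq_mul]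
  field_simp

lemma continuous_obs (n : ℕ) (f : Vertex → Fin 4 → ℝ) : Continuous (obs n f) := by
  induction n generalizing f with
  | zero => exact continuous_const
  | succ n ih =>
    have htail (b : Bool) : Continuous (tailConfig b) := continuous_pi fun u => continuous_apply _
    have hroot : Continuous fun η : Config => f [] (η []) :=
      continuous_of_discreteTopology.comp (continuous_apply ([] : Vertex))
    exact (hroot.mul ((ih _).comp (htail false))).mul ((ih _).comp (htail true))

lemma obs_eq_prod {n : ℕ} {f : Vertex → Fin 4 → ℝ} {I : Finset Vertex}
    (hI : ∀ u ∈ I, u.length < n) (hf : ∀ u ∉ I, f u = 1) (η : Config) :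
    obs n f η = ∏ u ∈ I, f u (η u) := by
  classical
  induction n generalizing f I η with
  | zero =>
    have hempty : I = ∅ := Finset.eq_empty_of_forall_notMem fun u hu => by simpa using hI u hu
    simp [hempty, obs]
  | succ n ih =>
    have hbranch (b : Bool) : obs n (shift b f) (tailConfig b η) =
        ∏ u ∈ finBranch b I, f (b :: u) (η (b :: u)) :=
      ih (fun u hu => by simpa using hI (b :: u) (mem_finBranch.1 hu))
        (fun u hu => hf (b :: u) (mt mem_finBranch.2 hu)) _
    rw [obs, prod_eq_mul_prod_finBranch, Fintype.prod_bool, hbranch, hbranch]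
    split_ifs with h
    · ring
    · rw [hf [] h, Pi.one_apply]
      ring

lemma exists_obs_eq_indicator (I : Finset Vertex) (ξ : I → Fin 4) :
    ∃ n f, obs n f = (I.restrict ⁻¹' {ξ} : Set Config).indicator 1 := by
  classical
  let f : Vertex → Fin 4 → ℝ := fun u =>
    if hu : u ∈ I then fun h => if h = ξ ⟨u, hu⟩ then 1 else 0 else 1
  refine ⟨I.sup List.length + 1, f, funext fun η => ?_⟩
  rw [obs_eq_prod (fun u hu => Nat.lt_succ_of_le (Finset.le_sup (f := List.length) hu))
    (fun u hu => by simp [f, hu])]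
  by_cases hη : I.restrict η = ξ
  · rw [Set.indicator_of_mem (by exact hη), Pi.one_apply]
    exact Finset.prod_eq_one fun u hu => by simp [f, hu, ← hη]
  · rw [Set.indicator_of_notMem (by exact hη)]
    obtain ⟨u, hu⟩ := Function.ne_iff.1 hη
    exact Finset.prod_eq_zero u.2 (by simpa [f] using hu)

lemma ext_of_integral_obs {μ ν : Measure Config} [IsProbabilityMeasure μ]
    [IsProbabilityMeasure ν] (h : ∀ n f, ∫ η, obs n f η ∂μ = ∫ η, obs n f η ∂ν) : μ = ν := by
  have hproj (I : Finset Vertex) : ν.map I.restrict = μ.map I.restrict := by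
    refine Measure.ext_of_singleton fun ξ => ?_
    have hmeas : MeasurableSet (I.restrict ⁻¹' {ξ} : Set Config) :=
      (measurableSet_singleton _).preimage (by fun_prop)
    obtain ⟨n, f, hf⟩ := exists_obs_eq_indicator I ξ
    have hcyl := h n f
    rw [hf, integral_indicator_one hmeas, integral_indicator_one hmeas] at hcyl
    rw [Measure.map_apply (by fun_prop) (measurableSet_singleton _),
      Measure.map_apply (by fun_prop) (measurableSet_singleton _)]
    exact ((measureReal_eq_measureReal_iff).1 hcyl).symm
  exact IsProjectiveLimit.unique (P := fun I => μ.map I.restrict) (fun I => rfl) hproj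

lemma tendsto_integral_obs {ι : Type*} {l : Filter ι} {μs : ι → ProbabilityMeasure Config}
    {μ : ProbabilityMeasure Config} (h : Tendsto μs l (𝓝 μ)) (n : ℕ)
    (f : Vertex → Fin 4 → ℝ) :
    Tendsto (fun i => ∫ η, obs n f η ∂(μs i : Measure Config)) l
      (𝓝 (∫ η, obs n f η ∂(μ : Measure Config))) :=
  ProbabilityMeasure.tendsto_iff_forall_integral_tendsto.1 h
    (BoundedContinuousFunction.mkOfCompact ⟨obs n f, continuous_obs n f⟩)

lemma exhausts_finiteSubtree {T : Set Vertex} (hT : IsRootedSubtree T) :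
    Exhausts (atTop : Filter (FiniteSubtree T)) (fun T' => T'.1) T where
  prefixClosed i := i.2.1.2
  subset i := i.2.2
  eventually_mem u hu := by
    have hpath : (u.inits.toFinset : Set Vertex) = {a | a <+: u} := by ext; simp
    let path : FiniteSubtree T := ⟨u.inits.toFinset, by
      rw [hpath]
      exact ⟨⟨List.nil_prefix, fun _ _ hab hb => hab.trans hb⟩, fun a ha => hT.2 a u ha hu⟩⟩
    filter_upwards [eventually_ge_atTop path] with i hi
    exact hi (by simp [path])

instance (T : Set Vertex) : IsDirectedOrder (FiniteSubtree T) := by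
  classical
  refine ⟨fun a b => ⟨⟨a.1 ∪ b.1, ⟨by simp [a.2.1.1], fun u v huv hv => ?_⟩, ?_⟩,
    Finset.subset_union_left, Finset.subset_union_right⟩⟩
  · simp only [Finset.coe_union, Set.mem_union] at hv ⊢
    exact hv.imp (a.2.1.2 u v huv) (b.2.1.2 u v huv)
  · simpa using ⟨a.2.2, b.2.2⟩

lemma nonempty_finiteSubtree {T : Set Vertex} (hT : IsRootedSubtree T) :
    Nonempty (FiniteSubtree T) :=
  ⟨⟨{[]}, ⟨by simp, fun u v huv hv => by simp_all⟩, by simpa using hT.1⟩⟩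

lemma integral_obs_of_mapClusterPt {T : Set Vertex} (hT : IsRootedSubtree T)
    {μ : ProbabilityMeasure Config}
    (hμ : MapClusterPt μ atTop fun T' : FiniteSubtree T => finiteSandpileMeasure T'.1)
    (n : ℕ) (f : Vertex → Fin 4 → ℝ) : ∫ η, obs n f η ∂(μ : Measure Config) = limMean n f T := by
  obtain ⟨U, hU, hUμ⟩ := mapClusterPt_iff_ultrafilter.1 hμ
  exact tendsto_nhds_unique (tendsto_integral_obs hUμ n f)
    (((exhausts_finiteSubtree hT).mono hU).tendsto_mean n f)

lemma exists_isSandpileMeasure {T : Set Vertex} (hT : IsRootedSubtree T) :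
    ∃ μ, IsSandpileMeasure T μ := by
  have := nonempty_finiteSubtree hT
  obtain ⟨μ, hμ⟩ := exists_clusterPt_of_compactSpace
    (map (fun T' : FiniteSubtree T => finiteSandpileMeasure T'.1) atTop)
  refine ⟨μ, le_nhds_of_unique_clusterPt fun ν hν => Subtype.ext ?_⟩
  refine ext_of_integral_obs (μ := (ν : Measure Config)) (ν := (μ : Measure Config)) fun n f => ?_
  rw [integral_obs_of_mapClusterPt hT hμ, integral_obs_of_mapClusterPt hT hν]

lemma IsSandpileMeasure.integral_obs {T : Set Vertex} (hT : IsRootedSubtree T)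
    {μ : ProbabilityMeasure Config} (hμ : IsSandpileMeasure T μ) (n : ℕ)
    (f : Vertex → Fin 4 → ℝ) : ∫ η, obs n f η ∂(μ : Measure Config) = limMean n f T :=
  have := nonempty_finiteSubtree hT
  integral_obs_of_mapClusterPt hT (Tendsto.mapClusterPt hμ) n f

/-! ### The covariance of the root with a vertex -/

/-- The height as a real number. -/
def height (h : Fin 4) : ℝ := ((h : ℕ) : ℝ)

@[simp] lemma height_one : height 1 = 1 := by norm_num [height]

@[simp] lemma height_two : height 2 = 2 := by simp [height]

@[simp] lemma height_three : height 3 = 3 := by simp [height]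

lemma shift_one (b : Bool) : shift b 1 = 1 := rfl

lemma shift_mul (b : Bool) (f g : Vertex → Fin 4 → ℝ) :
    shift b (f * g) = shift b f * shift b g := rfl

lemma shift_mulSingle_cons (b : Bool) (v : Vertex) (g : Fin 4 → ℝ) :
    shift b (Pi.mulSingle (b :: v) g) = Pi.mulSingle v g := by
  funext u
  simp [shift, Pi.mulSingle_apply]

lemma shift_not_mulSingle_cons (b : Bool) (v : Vertex) (g : Fin 4 → ℝ) :
    shift (!b) (Pi.mulSingle (b :: v) g) = 1 := by
  funext u
  simp [shift]

lemma shift_mulSingle_nil (b : Bool) (g : Fin 4 → ℝ) : shift b (Pi.mulSingle [] g) = 1 := by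
  funext u
  simp [shift]

lemma obs_mul (n : ℕ) (f g : Vertex → Fin 4 → ℝ) (η : Config) :
    obs n (f * g) η = obs n f η * obs n g η := by
  induction n generalizing f g η with
  | zero => simp [obs]
  | succ n ih =>
    rw [obs, obs, obs, shift_mul, shift_mul, ih, ih, Pi.mul_apply, Pi.mul_apply]
    ring

lemma obs_mulSingle {n : ℕ} {v : Vertex} (hn : v.length < n) (g : Fin 4 → ℝ) (η : Config) :
    obs n (Pi.mulSingle v g) η = g (η v) := by
  rw [obs_eq_prod (I := {v}) (by simpa using hn) (by simp +contextual)]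
  simp

lemma memLp_height (μ : ProbabilityMeasure Config) (u : Vertex) :
    MemLp (fun η : Config => height (η u)) 2 (μ : Measure Config) := by
  have hmeas : Measurable fun η : Config => height (η u) :=
    (measurable_of_finite height).comp (measurable_pi_apply u)
  refine MemLp.of_bound hmeas.aestronglyMeasurable 3 (Eventually.of_forall fun η => ?_)
  rw [height, Real.norm_natCast]
  exact_mod_cast Nat.le_of_lt_succ (η u).isLt

lemma heightCov_eq_sub {T : Set Vertex} (hT : IsRootedSubtree T) {μ : ProbabilityMeasure Config}
    (hμ : IsSandpileMeasure T μ) {u v : Vertex} {n : ℕ} (hu : u.length < n) (hv : v.length < n) :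
    heightCov μ u v = limMean n (Pi.mulSingle u height * Pi.mulSingle v height) T -
      limMean n (Pi.mulSingle u height) T * limMean n (Pi.mulSingle v height) T := by
  rw [← hμ.integral_obs hT, ← hμ.integral_obs hT, ← hμ.integral_obs hT]
  simp only [obs_mul, obs_mulSingle hu, obs_mulSingle hv]
  exact covariance_eq_sub (memLp_height μ u) (memLp_height μ v)

lemma treeRatio_eq {T : Set Vertex} (hT : [] ∈ T) (b : Bool) : treeRatio T =
    (1 + treeRatio (branch b T)) * (1 + treeRatio (branch (!b) T)) /
      (2 + treeRatio (branch b T) + treeRatio (branch (!b) T)) := by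
  rw [treeRatio_node hT, ratioStep_eq_div (treeRatio_nonneg _) (treeRatio_nonneg _)]
  cases b
  · rfl
  · simp only [Bool.not_true]
    ring

lemma limSums_one (n : ℕ) (T : Set Vertex) : limSums n 1 T = (1, treeRatio T) := by
  induction n generalizing T with
  | zero => rfl
  | succ n ih =>
    rw [limSums, shift_one, shift_one, ih, ih, obs_one]
    split_ifs with h0
    · have hpos := two_add_treeRatio_pos (branch false T) (branch true T)
      rw [treeRatio_node h0, ratioStep_eq_div (treeRatio_nonneg _) (treeRatio_nonneg _)]
      ext <;> simp only [nodeSums, Pi.one_apply, Prod.smul_fst, Prod.smul_snd, smul_eq_mul] <;>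
        field_simp <;> ring
    · simp [treeRatio_of_notMem h0]

lemma limSums_node {T : Set Vertex} (hT : [] ∈ T) (b : Bool) (n : ℕ)
    (f : Vertex → Fin 4 → ℝ) : limSums (n + 1) f T =
      (2 + treeRatio (branch b T) + treeRatio (branch (!b) T))⁻¹ •
        nodeSums (f []) (limSums n (shift b f) (branch b T))
          (limSums n (shift (!b) f) (branch (!b) T)) := by
  rw [limSums, if_pos hT]
  cases b
  · rfl
  · rw [nodeSums_comm, add_right_comm]
    rfl

/-- The determinant `S * X - W`, where `S` and `W` are the limits of the normalized sums of the
height at `v` over strongly and weakly allowed configurations, and `X` is the characteristic ratio.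
It governs the covariance of the heights at the root and at `v`. -/
def pathDelta : Vertex → Set Vertex → ℝ
  | [], T => (3 + 3 * (treeRatio (branch false T) + treeRatio (branch true T)) +
      (treeRatio (branch false T) + treeRatio (branch true T)) ^ 2 -
      treeRatio (branch false T) * treeRatio (branch true T)) /
      (2 + treeRatio (branch false T) + treeRatio (branch true T)) ^ 2
  | b :: v, T => (theta (branch b T) / (theta (branch b T) + theta (branch (!b) T))) ^ 2 *
      pathDelta v (branch b T)

lemma limSums_mulSingle_height {n : ℕ} {v : Vertex} {T : Set Vertex} (hT : PrefixClosed T)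
    (hv : v ∈ T) (hn : v.length < n) :
    (limSums n (Pi.mulSingle v height) T).1 * treeRatio T -
      (limSums n (Pi.mulSingle v height) T).2 = pathDelta v T := by
  induction v generalizing n T with
  | nil =>
    obtain ⟨m, rfl⟩ := Nat.exists_eq_succ_of_ne_zero (Nat.ne_zero_of_lt hn)
    have hpos := two_add_treeRatio_pos (branch false T) (branch true T)
    rw [limSums_node hv false, treeRatio_eq hv false, shift_mulSingle_nil, shift_mulSingle_nil,
      Pi.mulSingle_eq_same, limSums_one, limSums_one, pathDelta]
    simp only [nodeSums, height_one, height_two, height_three, Prod.smul_fst, Prod.smul_snd,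
      smul_eq_mul, Bool.not_false]
    field_simp
    ring
  | cons b v ih =>
    have h0 : [] ∈ T := hT [] _ List.nil_prefix hv
    obtain ⟨m, rfl⟩ := Nat.exists_eq_succ_of_ne_zero (Nat.ne_zero_of_lt hn)
    have hx := treeRatio_nonneg (branch b T)
    have hy := treeRatio_nonneg (branch (!b) T)
    rw [limSums_node h0 b, treeRatio_eq h0 b, shift_mulSingle_cons, shift_not_mulSingle_cons,
      Pi.mulSingle_eq_of_ne (List.cons_ne_nil b v).symm, limSums_one, pathDelta,
      ← ih (hT.branch b) hv (by simpa using hn)]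
    simp only [nodeSums, theta, Pi.one_apply, Prod.smul_fst, Prod.smul_snd, smul_eq_mul]
    field_simp
    ring

/-- The determinant `pathDelta`, divided by the square of the partition sum with weight `r₁` of
the strongly and `r₂` of the weakly allowed configurations. -/
def pathKernel (v : Vertex) (r₁ r₂ : ℝ) (T : Set Vertex) : ℝ :=
  pathDelta v T / (r₁ + r₂ * treeRatio T) ^ 2

lemma pathKernel_cons {b : Bool} {v : Vertex} {T : Set Vertex} (hT : [] ∈ T) (r₁ r₂ : ℝ) :
    pathKernel (b :: v) r₁ r₂ T =
      pathKernel v (r₁ * (1 + theta (branch (!b) T)) + r₂) (r₁ * theta (branch (!b) T) + r₂)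
        (branch b T) := by
  have hθ := theta_pos (branch b T)
  have hθ' := theta_pos (branch (!b) T)
  have hfactor : r₁ + r₂ * treeRatio T =
      theta (branch b T) / (theta (branch b T) + theta (branch (!b) T)) *
        (r₁ * (1 + theta (branch (!b) T)) + r₂ +
          (r₁ * theta (branch (!b) T) + r₂) * treeRatio (branch b T)) := by
    have hx := treeRatio_nonneg (branch b T)
    have hy := treeRatio_nonneg (branch (!b) T)
    rw [treeRatio_eq hT b]
    simp only [theta]
    field_simp
    ring
  rw [pathKernel, pathKernel, hfactor, pathDelta, mul_pow, mul_div_mul_left]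
  positivity

lemma limMean_node {T : Set Vertex} (hT : [] ∈ T) (b : Bool) (n : ℕ) (f : Vertex → Fin 4 → ℝ) :
    limMean (n + 1) f T =
      ((nodeSums (f []) (limSums n (shift b f) (branch b T))
          (limSums n (shift (!b) f) (branch (!b) T))).1 +
        (nodeSums (f []) (limSums n (shift b f) (branch b T))
          (limSums n (shift (!b) f) (branch (!b) T))).2) /
      (3 + 2 * (treeRatio (branch b T) + treeRatio (branch (!b) T)) +
        treeRatio (branch b T) * treeRatio (branch (!b) T)) := by
  have hx := treeRatio_nonneg (branch b T)
  have hy := treeRatio_nonneg (branch (!b) T)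
  rw [limMean, limSums_node hT b, treeRatio_eq hT b, Prod.smul_fst, Prod.smul_snd, smul_eq_mul,
    smul_eq_mul, ← mul_add]
  field_simp
  ring

lemma limMean_mulSingle_nil {T : Set Vertex} (hT : [] ∈ T) (b : Bool) (n : ℕ) (g : Fin 4 → ℝ) :
    limMean (n + 1) (Pi.mulSingle [] g) T =
      (g 1 + (1 + treeRatio (branch b T) + treeRatio (branch (!b) T)) * g 2 +
        (1 + treeRatio (branch b T)) * (1 + treeRatio (branch (!b) T)) * g 3) /
      (3 + 2 * (treeRatio (branch b T) + treeRatio (branch (!b) T)) +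
        treeRatio (branch b T) * treeRatio (branch (!b) T)) := by
  rw [limMean_node hT b, shift_mulSingle_nil, shift_mulSingle_nil, limSums_one, limSums_one,
    Pi.mulSingle_eq_same]
  simp only [nodeSums]
  ring

lemma heightCov_nil_pos {T : Set Vertex} (hT : IsRootedSubtree T) {μ : ProbabilityMeasure Config}
    (hμ : IsSandpileMeasure T μ) : 0 < heightCov μ [] [] := by
  have hx := treeRatio_nonneg (branch false T)
  have hy := treeRatio_nonneg (branch true T)
  rw [heightCov_eq_sub hT hμ Nat.zero_lt_one Nat.zero_lt_one, ← Pi.mulSingle_mul,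
    limMean_mulSingle_nil hT.1 false 0, limMean_mulSingle_nil hT.1 false 0]
  simp only [Pi.mul_apply, height_one, height_two, height_three, Bool.not_false]
  rw [div_mul_div_comm, div_sub_div _ _ (by positivity) (by positivity)]
  refine div_pos ?_ (by positivity)
  ring_nf
  positivity

lemma heightCov_cons {T : Set Vertex} (hT : IsRootedSubtree T) {μ : ProbabilityMeasure Config}
    (hμ : IsSandpileMeasure T μ) {b : Bool} {v : Vertex} (hv : b :: v ∈ T) :
    heightCov μ [] (b :: v) = -((1 + theta (branch (!b) T) + theta (branch (!b) T) ^ 2) *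
      pathKernel (b :: v) 1 1 T) := by
  have hx := treeRatio_nonneg (branch b T)
  have hy := treeRatio_nonneg (branch (!b) T)
  rw [heightCov_eq_sub (n := v.length + 2) hT hμ (by simp) (by simp),
    limMean_mulSingle_nil hT.1 b, limMean_node hT.1 b, limMean_node hT.1 b,
    shift_mul, shift_mul, shift_mulSingle_nil, shift_mulSingle_nil, one_mul, one_mul,
    shift_mulSingle_cons, shift_not_mulSingle_cons, limSums_one, Pi.mul_apply,
    Pi.mulSingle_eq_same, Pi.mulSingle_eq_of_ne (List.cons_ne_nil b v).symm, mul_one,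
    pathKernel_cons hT.1, pathKernel,
    ← limSums_mulSingle_height (PrefixClosed.branch hT.2 b) hv (Nat.lt_succ_self v.length)]
  generalize limSums (v.length + 1) (Pi.mulSingle v height) (branch b T) = P
  simp only [nodeSums, theta, Pi.one_apply, height_one, height_two, height_three]
  field_simp
  ring

lemma pathDelta_nil_le_one (T : Set Vertex) : pathDelta [] T ≤ 1 := by
  have hx := treeRatio_nonneg (branch false T)
  have hy := treeRatio_nonneg (branch true T)
  rw [pathDelta, div_le_one (by positivity)]
  nlinarith [mul_nonneg hx hy]

lemma le_pathDelta_nil (T : Set Vertex) : 3 / 4 ≤ pathDelta [] T := by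
  have hpos := two_add_treeRatio_pos (branch false T) (branch true T)
  rw [pathDelta, le_div_iff₀ (by positivity)]
  nlinarith [sq_nonneg (treeRatio (branch false T) - treeRatio (branch true T))]

lemma pathDelta_pos (v : Vertex) (T : Set Vertex) : 0 < pathDelta v T := by
  induction v generalizing T with
  | nil => linarith [le_pathDelta_nil T]
  | cons b v ih =>
    have hθ := theta_pos (branch b T)
    have hθ' := theta_pos (branch (!b) T)
    have hv := ih (branch b T)
    rw [pathDelta]
    positivity

lemma pathKernel_pos (v : Vertex) {r₁ r₂ : ℝ} (h₁ : 0 < r₁) (h₂ : 0 ≤ r₂) (T : Set Vertex) :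
    0 < pathKernel v r₁ r₂ T := by
  have hT := treeRatio_nonneg T
  have hv := pathDelta_pos v T
  unfold pathKernel
  positivity

lemma pathKernel_nil_mem_Icc {r₁ r₂ : ℝ} (hr₂ : 0 < r₂) (hle : r₂ ≤ r₁) (T : Set Vertex) :
    pathKernel [] r₁ r₂ T ∈ Set.Icc (3 / 4 * ((r₁ + r₂) ^ 2)⁻¹) (4 * ((r₁ + r₂) ^ 2)⁻¹) := by
  have hx := treeRatio_nonneg T
  have hx1 := treeRatio_le_one T
  have hr₁ := hr₂.trans_le hle
  have hK : pathKernel [] r₁ r₂ T = pathDelta [] T * ((r₁ + r₂ * treeRatio T) ^ 2)⁻¹ :=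
    div_eq_mul_inv _ _
  rw [hK]
  constructor
  · have hden : r₁ + r₂ * treeRatio T ≤ r₁ + r₂ := by nlinarith
    exact mul_le_mul (le_pathDelta_nil T) (by gcongr) (by positivity)
      (le_trans (by norm_num) (le_pathDelta_nil T))
  · have hsq : ((r₁ + r₂ * treeRatio T) ^ 2)⁻¹ ≤ (((r₁ + r₂) / 2) ^ 2)⁻¹ := by
      gcongr
      nlinarith
    calc pathDelta [] T * ((r₁ + r₂ * treeRatio T) ^ 2)⁻¹
        ≤ 1 * (((r₁ + r₂) / 2) ^ 2)⁻¹ := by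
          gcongr
          exact pathDelta_nil_le_one T
      _ = 4 * ((r₁ + r₂) ^ 2)⁻¹ := by
          field_simp
          norm_num

lemma abs_heightCov_cons_mem_Icc {T : Set Vertex} (hT : IsRootedSubtree T)
    {μ : ProbabilityMeasure Config} (hμ : IsSandpileMeasure T μ) {b : Bool} {v : Vertex}
    (hv : b :: v ∈ T) : |heightCov μ [] (b :: v)| ∈
      Set.Icc (pathKernel (b :: v) 1 1 T) (3 * pathKernel (b :: v) 1 1 T) := by
  have hθ := theta_pos (branch (!b) T)
  have hθ1 := theta_le_one (branch (!b) T)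
  have hK := pathKernel_pos (b :: v) one_pos zero_le_one T
  rw [heightCov_cons hT hμ hv, abs_neg, abs_of_pos (by positivity)]
  constructor
  · exact le_mul_of_one_le_left hK.le (by nlinarith)
  · gcongr
    nlinarith

lemma heightCov_ne_zero {T : Set Vertex} (hT : IsRootedSubtree T) {μ : ProbabilityMeasure Config}
    (hμ : IsSandpileMeasure T μ) {v : Vertex} (hv : v ∈ T) : heightCov μ [] v ≠ 0 := by
  rcases v with _ | ⟨b, v⟩
  · exact (heightCov_nil_pos hT hμ).ne'
  · exact abs_pos.1 ((pathKernel_pos (b :: v) one_pos zero_le_one T).trans_le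
      (abs_heightCov_cons_mem_Icc hT hμ hv).1)

/-! ### The random tree -/

/-- The branching variables of the descendants of the child `[b]` of the root. -/
def tailBranching (b : Bool) (ω : Branching) : Branching := fun u => ω (b :: u)

lemma measurable_tailBranching (b : Bool) : Measurable (tailBranching b) :=
  measurable_pi_lambda _ fun _ => measurable_pi_apply _

lemma measurableSet_root_branches : MeasurableSet {ω : Branching | ω [] = true} :=
  measurable_pi_apply (X := fun _ : Vertex => Bool) [] (measurableSet_singleton true)

lemma nil_mem_randomTree (ω : Branching) : [] ∈ randomTree ω :=
  fun _ hu hne => absurd (List.prefix_nil.1 hu) hne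

lemma cons_mem_randomTree {b : Bool} {v : Vertex} {ω : Branching} :
    b :: v ∈ randomTree ω ↔ ω [] = true ∧ v ∈ randomTree (tailBranching b ω) := by
  constructor
  · intro h
    exact ⟨h [] List.nil_prefix (by simp), fun u hu hne => h (b :: u) (by simpa using hu)
      (by simpa using hne)⟩
  · rintro ⟨h0, h⟩ u hu hne
    rcases u with _ | ⟨a, u⟩
    · exact h0
    · obtain ⟨rfl, hu'⟩ := List.cons_prefix_cons.1 hu
      exact h u hu' (by simpa using hne)

lemma isRootedSubtree_randomTree (ω : Branching) : IsRootedSubtree (randomTree ω) := by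
  refine ⟨nil_mem_randomTree ω, fun u v huv hv w hwu hne => hv w (hwu.trans huv) ?_⟩
  rintro rfl
  exact hne (hwu.eq_of_length_le huv.length_le)

lemma branch_randomTree {ω : Branching} (h : ω [] = true) (b : Bool) :
    branch b (randomTree ω) = randomTree (tailBranching b ω) := by
  ext u
  simp [cons_mem_randomTree, h]

lemma branch_randomTree_of_ne {ω : Branching} (h : ω [] ≠ true) (b : Bool) :
    branch b (randomTree ω) = ∅ := by
  ext u
  simp [cons_mem_randomTree, h]

lemma measurableSet_mem_randomTree (v : Vertex) :
    MeasurableSet {ω : Branching | v ∈ randomTree ω} := by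
  induction v with
  | nil => simp [nil_mem_randomTree]
  | cons b v ih =>
    simp only [cons_mem_randomTree]
    exact measurableSet_root_branches.inter (measurable_tailBranching b ih)

lemma measurable_branch_randomTree {β : Type*} [MeasurableSpace β] {g : Set Vertex → β}
    (hg : Measurable fun ω => g (randomTree ω)) (b : Bool) :
    Measurable fun ω => g (branch b (randomTree ω)) := by
  have heq (ω : Branching) : g (branch b (randomTree ω)) =
      if ω [] = true then g (randomTree (tailBranching b ω)) else g ∅ := by
    split_ifs with hω
    · rw [branch_randomTree hω]
    · rw [branch_randomTree_of_ne hω]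
  simp only [heq]
  exact Measurable.ite measurableSet_root_branches (hg.comp (measurable_tailBranching b))
    measurable_const

lemma measurable_truncatedRatio_randomTree (n : ℕ) :
    Measurable fun ω => truncatedRatio n (randomTree ω) := by
  induction n with
  | zero => exact measurable_const
  | succ n ih =>
    have hbranch := measurable_branch_randomTree ih
    simp only [truncatedRatio, nil_mem_randomTree, if_true, ratioStep]
    exact (((hbranch false).const_add 1).inv.add ((hbranch true).const_add 1).inv).inv

lemma measurable_treeRatio_randomTree : Measurable fun ω => treeRatio (randomTree ω) :=
  measurable_of_tendsto_metrizable measurable_truncatedRatio_randomTree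
    (tendsto_pi_nhds.2 fun ω => tendsto_truncatedRatio (randomTree ω))

lemma measurable_theta_randomTree : Measurable fun ω => theta (randomTree ω) :=
  (measurable_treeRatio_randomTree.const_add 1).inv

lemma integrable_theta_randomTree (p : unitInterval) :
    Integrable (fun ω => theta (randomTree ω)) (branchingMeasure p) :=
  Integrable.of_bound measurable_theta_randomTree.aestronglyMeasurable 1
    (Eventually.of_forall fun ω => by
      rw [Real.norm_of_nonneg (theta_pos _).le]
      exact theta_le_one _)

lemma charRatio_randomTreeUpTo (N : ℕ) (ω : Branching) :
    charRatio (randomTreeUpTo N ω) = truncatedRatio (N + 1) (randomTree ω) := by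
  have hmem (u : Vertex) : u ∈ randomTreeUpTo N ω ↔ u ∈ randomTree ω ∧ u.length ≤ N := by
    simp [randomTreeUpTo]
  have hpc : PrefixClosed (randomTreeUpTo N ω : Set Vertex) := by
    intro u v huv hv
    rw [Finset.mem_coe, hmem] at hv ⊢
    exact ⟨(isRootedSubtree_randomTree ω).2 u v huv hv.1, huv.length_le.trans hv.2⟩
  rw [charRatio_eq_truncatedRatio hpc fun u hu => Nat.lt_succ_of_le ((hmem u).1 hu).2]
  exact le_antisymm (truncatedRatio_le_of_subset fun u hu _ => ((hmem u).1 hu).1)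
    (truncatedRatio_le_of_subset fun u hu hlen => (hmem u).2 ⟨hu, Nat.le_of_lt_succ hlen⟩)

/-- The law of the characteristic ratio of the random tree: the limiting law of the theorem. -/
def ratioLaw (p : unitInterval) : ProbabilityMeasure ℝ :=
  ⟨(branchingMeasure p).map fun ω => treeRatio (randomTree ω),
    Measure.isProbabilityMeasure_map measurable_treeRatio_randomTree.aemeasurable⟩

lemma tendstoInDistribution_charRatio (p : unitInterval) :
    TendstoInDistribution (fun (N : ℕ) ω => charRatio (randomTreeUpTo N ω)) atTop
      (id : ℝ → ℝ) (fun _ => branchingMeasure p) (ratioLaw p : Measure ℝ) := by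
  simp only [charRatio_randomTreeUpTo]
  have hlim := tendstoInDistribution_of_ae_tendsto (μ' := branchingMeasure p)
    (fun N => (measurable_truncatedRatio_randomTree (N + 1)).aemeasurable)
    measurable_treeRatio_randomTree.aemeasurable
    (Eventually.of_forall fun ω =>
      (tendsto_truncatedRatio (randomTree ω)).comp (tendsto_add_atTop_nat 1))
  refine ⟨hlim.forall_aemeasurable, aemeasurable_id, ?_⟩
  convert hlim.tendsto using 2
  exact congrArg 𝓝 (Subtype.ext Measure.map_id)

lemma gammaOf_ratioLaw (p : unitInterval) :
    gammaOf (ratioLaw p : Measure ℝ) = (∫ ω, theta (randomTree ω) ∂(branchingMeasure p))⁻¹ := by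
  refine congrArg (·⁻¹) (integral_map measurable_treeRatio_randomTree.aemeasurable ?_)
  exact (by fun_prop : Measurable fun x : ℝ => (1 + x)⁻¹).aestronglyMeasurable

lemma measurable_pathDelta_randomTree (v : Vertex) :
    Measurable fun ω => pathDelta v (randomTree ω) := by
  have hratio := measurable_branch_randomTree measurable_treeRatio_randomTree
  have htheta := measurable_branch_randomTree measurable_theta_randomTree
  induction v with
  | nil =>
    have := hratio false
    have := hratio true
    simp only [pathDelta]
    fun_prop
  | cons b v ih =>
    have := htheta b
    have := htheta (!b)
    have := measurable_branch_randomTree ih b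
    simp only [pathDelta]
    fun_prop

lemma measurable_limSums_randomTree (n : ℕ) (f : Vertex → Fin 4 → ℝ) :
    Measurable fun ω => limSums n f (randomTree ω) := by
  have hratio := measurable_branch_randomTree measurable_treeRatio_randomTree
  induction n generalizing f with
  | zero => exact measurable_const.prodMk measurable_treeRatio_randomTree
  | succ n ih =>
    have hsums (b : Bool) := measurable_branch_randomTree (ih (shift b f)) b
    simp only [limSums, nil_mem_randomTree, if_true]
    exact (((hratio false).const_add 2).add (hratio true)).inv.smul
      ((continuous_nodeSums (f [])).measurable.comp ((hsums false).prodMk (hsums true)))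

lemma measurable_limMean_randomTree (n : ℕ) (f : Vertex → Fin 4 → ℝ) :
    Measurable fun ω => limMean n f (randomTree ω) := by
  have hsums := measurable_limSums_randomTree n f
  exact (hsums.fst.add hsums.snd).div (measurable_treeRatio_randomTree.const_add 1)

lemma measurable_heightCov_randomTree {μ : Set Vertex → ProbabilityMeasure Config}
    (hμ : ∀ T, IsRootedSubtree T → IsSandpileMeasure T (μ T)) (u v : Vertex) :
    Measurable fun ω => heightCov (μ (randomTree ω)) u v := by
  have heq (ω : Branching) := heightCov_eq_sub (isRootedSubtree_randomTree ω)
    (hμ _ (isRootedSubtree_randomTree ω)) (u := u) (v := v) (n := u.length + v.length + 1)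
    (by lia) (by lia)
  simp only [heq]
  exact (measurable_limMean_randomTree _ _).sub
    ((measurable_limMean_randomTree _ _).mul (measurable_limMean_randomTree _ _))

/-! ### Products of random matrices -/

lemma ofReal_integral_le_lintegral_ofReal {Ω : Type*} [MeasurableSpace Ω] {P : Measure Ω}
    {f : Ω → ℝ} (hf : Integrable f P) :
    ENNReal.ofReal (∫ ω, f ω ∂P) ≤ ∫⁻ ω, ENNReal.ofReal (f ω) ∂P := by
  rw [integral_eq_lintegral_pos_part_sub_lintegral_neg_part hf]
  exact (ENNReal.ofReal_le_ofReal (sub_le_self _ ENNReal.toReal_nonneg)).trans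
    ENNReal.ofReal_toReal_le

lemma ofReal_inv_sq_integral_le {Ω : Type*} [MeasurableSpace Ω] {P : Measure Ω}
    [IsProbabilityMeasure P] {X : Ω → ℝ} (hX : Integrable X P) (hpos : ∀ ω, 0 < X ω) :
    ENNReal.ofReal (((∫ ω, X ω ∂P) ^ 2)⁻¹) ≤ ∫⁻ ω, ENNReal.ofReal ((X ω ^ 2)⁻¹) ∂P := by
  obtain hM | hM := (integral_nonneg fun ω => (hpos ω).le : 0 ≤ ∫ ω, X ω ∂P).eq_or_lt
  · simp [← hM]
  set M := ∫ ω, X ω ∂P with hMdef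
  have htangent (x : ℝ) (hx : 0 < x) : 3 * (M ^ 2)⁻¹ - 2 * (M ^ 3)⁻¹ * x ≤ (x ^ 2)⁻¹ := by
    have hgap : (x ^ 2)⁻¹ - (3 * (M ^ 2)⁻¹ - 2 * (M ^ 3)⁻¹ * x) =
        (x - M) ^ 2 * (2 * x + M) / (x ^ 2 * M ^ 3) := by
      field_simp
      ring
    rw [← sub_nonneg, hgap]
    positivity
  calc ENNReal.ofReal ((M ^ 2)⁻¹)
      = ENNReal.ofReal (∫ ω, 3 * (M ^ 2)⁻¹ - 2 * (M ^ 3)⁻¹ * X ω ∂P) := by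
        rw [integral_sub (integrable_const _) (hX.const_mul _), integral_const,
          integral_const_mul, ← hMdef, probReal_univ, one_smul]
        congr 1
        field_simp
        norm_num
    _ ≤ ∫⁻ ω, ENNReal.ofReal (3 * (M ^ 2)⁻¹ - 2 * (M ^ 3)⁻¹ * X ω) ∂P :=
        ofReal_integral_le_lintegral_ofReal ((integrable_const _).sub (hX.const_mul _))
    _ ≤ ∫⁻ ω, ENNReal.ofReal ((X ω ^ 2)⁻¹) ∂P :=
        lintegral_mono fun ω => ENNReal.ofReal_le_ofReal (htangent _ (hpos ω))

section MatrixMoment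

variable {Ω : Type*} [MeasurableSpace Ω] (P : Measure Ω) (θ : Ω → ℝ)

/-- `E (r N₁ ⋯ Nₙ 1)⁻²` for the row vector `r = (r₁, r₂)` and independent copies `Nᵢ` of the
random matrix with rows `(1 + θ, θ)` and `(1, 1)`. -/
def matrixMoment : ℕ → ℝ → ℝ → ENNReal
  | 0, r₁, r₂ => ENNReal.ofReal (((r₁ + r₂) ^ 2)⁻¹)
  | n + 1, r₁, r₂ => ∫⁻ ω, matrixMoment n (r₁ * (1 + θ ω) + r₂) (r₁ * θ ω + r₂) ∂P

/-- `E Qₙ⁻²` for the sum `Qₙ` of the entries of the product of `n` independent copies of the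
random matrix. -/
def moment (n : ℕ) : ℝ := (matrixMoment P θ n 1 1).toReal

variable {P θ}

section Nonneg

variable (hθ : ∀ ω, 0 ≤ θ ω) {r₁ r₂ : ℝ} (hr₁ : 0 < r₁) (hr₂ : 0 < r₂)
include hθ hr₁ hr₂

lemma matrixMoment_le_mul (n : ℕ) {s₁ s₂ c : ℝ} (hs₁ : 0 < s₁) (hs₂ : 0 < s₂)
    (h₁ : r₁ ≤ c * s₁) (h₂ : r₂ ≤ c * s₂) :
    matrixMoment P θ n s₁ s₂ ≤ ENNReal.ofReal (c ^ 2) * matrixMoment P θ n r₁ r₂ := by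
  induction n generalizing r₁ r₂ s₁ s₂ with
  | zero =>
    rw [matrixMoment, matrixMoment, ← ENNReal.ofReal_mul (sq_nonneg c)]
    refine ENNReal.ofReal_le_ofReal ?_
    rw [← div_eq_mul_inv, inv_eq_one_div, div_le_div_iff₀ (by positivity) (by positivity),
      one_mul, ← mul_pow]
    gcongr
    linarith
  | succ n ih =>
    rw [matrixMoment, matrixMoment, ← lintegral_const_mul' _ _ ENNReal.ofReal_ne_top]
    refine lintegral_mono fun ω => ?_
    have hω := hθ ω
    refine ih (by positivity) (by positivity) (by positivity) (by positivity) ?_ ?_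
    · linear_combination (1 + θ ω) * h₁ + h₂
    · linear_combination θ ω * h₁ + h₂

variable [IsProbabilityMeasure P]

lemma matrixMoment_le (n : ℕ) :
    matrixMoment P θ n r₁ r₂ ≤ ENNReal.ofReal (((r₁ + r₂) ^ 2)⁻¹) := by
  induction n generalizing r₁ r₂ with
  | zero => exact le_rfl
  | succ n ih =>
    have hstep (ω : Ω) : matrixMoment P θ n (r₁ * (1 + θ ω) + r₂) (r₁ * θ ω + r₂) ≤
        ENNReal.ofReal (((r₁ + r₂) ^ 2)⁻¹) := by
      have hω := hθ ω
      refine (ih (by positivity) (by positivity)).trans ?_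
      gcongr
      · nlinarith
      · exact le_add_of_nonneg_left (by positivity)
    exact (lintegral_mono hstep).trans (by simp)

lemma matrixMoment_ne_top (n : ℕ) : matrixMoment P θ n r₁ r₂ ≠ ⊤ :=
  ((matrixMoment_le hθ hr₁ hr₂ n).trans_lt ENNReal.ofReal_lt_top).ne

lemma matrixMoment_mul_le (n m : ℕ) :
    matrixMoment P θ n r₁ r₂ * matrixMoment P θ m 1 1 ≤ matrixMoment P θ (n + m) r₁ r₂ := by
  induction n generalizing r₁ r₂ with
  | zero =>
    have hcompare := matrixMoment_le_mul (P := P) hθ hr₁ hr₂ m (c := r₁ + r₂) one_pos one_pos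
      (by linarith) (by linarith)
    rw [matrixMoment, zero_add]
    refine (mul_le_mul_right hcompare _).trans ?_
    rw [← mul_assoc, ← ENNReal.ofReal_mul (by positivity), inv_mul_cancel₀ (by positivity),
      ENNReal.ofReal_one, one_mul]
  | succ n ih =>
    rw [add_right_comm, matrixMoment, matrixMoment,
      ← lintegral_mul_const' _ _ (matrixMoment_ne_top hθ one_pos one_pos m)]
    refine lintegral_mono fun ω => ?_
    have hω := hθ ω
    exact ih (by positivity) (by positivity)

/-- By Jensen's inequality the moment is minimal for deterministic matrices. The vector `(w₁, w₂)`
is an eigenvector of the mean matrix. -/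
lemma le_matrixMoment (hintegrable : Integrable θ P) {l w₁ w₂ : ℝ} (hw₁ : 1 ≤ w₁) (hw₂ : 1 ≤ w₂)
    (hl₁ : (1 + ∫ ω, θ ω ∂P) * w₁ + (∫ ω, θ ω ∂P) * w₂ = l * w₁) (hl₂ : w₁ + w₂ = l * w₂)
    (n : ℕ) :
    ENNReal.ofReal (((l ^ n * (r₁ * w₁ + r₂ * w₂)) ^ 2)⁻¹) ≤ matrixMoment P θ n r₁ r₂ := by
  have hl : 0 < l := pos_of_mul_pos_left (hl₂ ▸ by positivity : 0 < l * w₂) (by positivity)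
  induction n generalizing r₁ r₂ with
  | zero =>
    rw [matrixMoment, pow_zero, one_mul]
    gcongr
    · exact le_mul_of_one_le_right hr₁.le hw₁
    · exact le_mul_of_one_le_right hr₂.le hw₂
  | succ n ih =>
    have hX : Integrable
        (fun ω => l ^ n * ((r₁ * (1 + θ ω) + r₂) * w₁ + (r₁ * θ ω + r₂) * w₂)) P := by
      fun_prop
    have hmean : ∫ ω, l ^ n * ((r₁ * (1 + θ ω) + r₂) * w₁ + (r₁ * θ ω + r₂) * w₂) ∂P =
        l ^ (n + 1) * (r₁ * w₁ + r₂ * w₂) := by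
      have haffine (ω : Ω) : l ^ n * ((r₁ * (1 + θ ω) + r₂) * w₁ + (r₁ * θ ω + r₂) * w₂) =
          l ^ n * (r₁ * w₁ + r₂ * w₁ + r₂ * w₂) + l ^ n * (r₁ * (w₁ + w₂)) * θ ω := by ring
      simp only [haffine]
      rw [integral_add (integrable_const _) (hintegrable.const_mul _), integral_const,
        integral_const_mul, probReal_univ, one_smul, pow_succ]
      linear_combination l ^ n * r₁ * hl₁ + l ^ n * r₂ * hl₂
    rw [← hmean, matrixMoment]
    refine (ofReal_inv_sq_integral_le hX fun ω => ?_).trans (lintegral_mono fun ω => ?_)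
    · have hω := hθ ω
      positivity
    · have hω := hθ ω
      exact ih (by positivity) (by positivity)

end Nonneg

/-- The largest eigenvalue of the matrix with rows `(1 + m, m)` and `(1, 1)`. -/
def growth (m : ℝ) : ℝ := (2 + m + √(m ^ 2 + 4 * m)) / 2

lemma growth_sub_one_sq {m : ℝ} (hm : 0 ≤ m) : (growth m - 1) ^ 2 = m * growth m := by
  have hsqrt := Real.sq_sqrt (by positivity : 0 ≤ m ^ 2 + 4 * m)
  rw [growth]
  linear_combination hsqrt / 4

lemma one_lt_growth {m : ℝ} (hm : 0 < m) : 1 < growth m := by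
  have hsqrt := Real.sqrt_nonneg (m ^ 2 + 4 * m)
  rw [growth]
  linarith

section Rate

variable [IsProbabilityMeasure P] (hθ : ∀ ω, 0 ≤ θ ω)
include hθ

lemma moment_le_one (n : ℕ) : moment P θ n ≤ 1 := by
  refine ENNReal.toReal_le_of_le_ofReal zero_le_one
    ((matrixMoment_le hθ one_pos one_pos n).trans (ENNReal.ofReal_le_ofReal ?_))
  norm_num

lemma moment_mul_le (n m : ℕ) : moment P θ n * moment P θ m ≤ moment P θ (n + m) := by
  rw [moment, moment, ← ENNReal.toReal_mul]
  exact ENNReal.toReal_mono (matrixMoment_ne_top hθ one_pos one_pos _)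
    (matrixMoment_mul_le hθ one_pos one_pos n m)

variable (hintegrable : Integrable θ P) (hm : 0 < ∫ ω, θ ω ∂P)
include hintegrable hm

lemma exists_le_moment :
    ∃ C > 0, ∀ n, ((growth (∫ ω, θ ω ∂P) ^ n * C) ^ 2)⁻¹ ≤ moment P θ n := by
  have hl := one_lt_growth hm
  have heq := growth_sub_one_sq hm.le
  set m := ∫ ω, θ ω ∂P
  set l := growth m
  have hl₁ : 0 < l - 1 := sub_pos.2 hl
  refine ⟨l + l / (l - 1), by positivity, fun n => ?_⟩
  have hle := le_matrixMoment hθ one_pos one_pos hintegrable (l := l) (w₁ := l) (w₂ := l / (l - 1))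
    hl.le ((one_le_div hl₁).2 (by linarith)) (by field_simp; linear_combination -heq)
    (by field_simp; ring) n
  rw [one_mul, one_mul] at hle
  exact (ENNReal.ofReal_le_iff_le_toReal (matrixMoment_ne_top hθ one_pos one_pos n)).1 hle

lemma moment_pos (n : ℕ) : 0 < moment P θ n := by
  obtain ⟨C, hC, hle⟩ := exists_le_moment hθ hintegrable hm
  have hl := zero_lt_one.trans (one_lt_growth hm)
  exact lt_of_lt_of_le (by positivity) (hle n)

lemma exists_tendsto_neg_log_moment : ∃ L : ℝ,
    Tendsto (fun n : ℕ => -Real.log (moment P θ n) / n) atTop (𝓝 L) ∧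
      L ≤ Real.log (growth (∫ ω, θ ω ∂P) ^ 2) := by
  have hpos := moment_pos hθ hintegrable hm
  have hsub : Subadditive fun n => -Real.log (moment P θ n) := fun n m => by
    have hlog := Real.log_le_log (mul_pos (hpos n) (hpos m)) (moment_mul_le hθ n m)
    rw [Real.log_mul (hpos n).ne' (hpos m).ne'] at hlog
    linarith
  have hbdd : BddBelow (Set.range fun n : ℕ => -Real.log (moment P θ n) / n) :=
    ⟨0, Set.forall_mem_range.2 fun n => div_nonneg
      (neg_nonneg.2 (Real.log_nonpos (hpos n).le (moment_le_one hθ n))) n.cast_nonneg⟩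
  obtain ⟨C, hC, hle⟩ := exists_le_moment hθ hintegrable hm
  have hl := zero_lt_one.trans (one_lt_growth hm)
  set l := growth (∫ ω, θ ω ∂P)
  have hlim : Tendsto (fun n : ℕ => Real.log (l ^ 2) + Real.log (C ^ 2) / n) atTop
      (𝓝 (Real.log (l ^ 2))) := by
    have hadd := (tendsto_const_nhds (x := Real.log (l ^ 2))).add
      (tendsto_const_div_atTop_nhds_zero_nat (Real.log (C ^ 2)))
    rwa [add_zero] at hadd
  refine ⟨hsub.lim, hsub.tendsto_lim hbdd, le_of_tendsto_of_tendsto (hsub.tendsto_lim hbdd) hlim ?_⟩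
  filter_upwards [eventually_gt_atTop 0] with n hn
  have hlog := Real.log_le_log (by positivity) (hle n)
  rw [mul_pow, Real.log_inv, Real.log_mul (by positivity) (by positivity), ← pow_mul,
    mul_comm n, pow_mul, Real.log_pow] at hlog
  rw [div_le_iff₀ (by positivity), add_mul, div_mul_cancel₀ _ (by positivity)]
  linarith

end Rate

end MatrixMoment

/-! ### Conditioning the random tree on containing a vertex -/

/-- Assembles the branching variables from the one at the root and those of the descendants of
`[!b]` and of `[b]`. -/
def joinBranching (b : Bool) (x : Bool × Branching × Branching) : Branching
  | [] => x.1
  | a :: u => if a = b then x.2.2 u else x.2.1 u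

lemma tailBranching_joinBranching (b : Bool) (x : Bool × Branching × Branching) :
    tailBranching b (joinBranching b x) = x.2.2 := by
  funext u
  simp [tailBranching, joinBranching]

lemma tailBranching_not_joinBranching (b : Bool) (x : Bool × Branching × Branching) :
    tailBranching (!b) (joinBranching b x) = x.2.1 := by
  funext u
  simp [tailBranching, joinBranching]

lemma measurable_joinBranching (b : Bool) : Measurable (joinBranching b) := by
  refine measurable_pi_lambda _ fun u => ?_
  rcases u with _ | ⟨a, u⟩
  · exact measurable_fst
  · simp only [joinBranching]
    split_ifs <;> fun_prop

lemma joinBranching_preimage_pi (b : Bool) (s : Finset Vertex) (t : Vertex → Set Bool) :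
    joinBranching b ⁻¹' (Set.pi s t) = {x | [] ∈ s → x ∈ t []} ×ˢ
      (Set.pi (finBranch (!b) s) fun u => t ((!b) :: u)) ×ˢ
        (Set.pi (finBranch b s) fun u => t (b :: u)) := by
  ext ⟨x, ω₀, ω₁⟩
  simp only [Set.mem_preimage, Set.mem_pi, Finset.mem_coe, Set.mem_prod, mem_finBranch,
    Set.mem_ofPred_eq]
  constructor
  · intro h
    exact ⟨h [], fun u hu => by simpa [joinBranching] using h _ hu,
      fun u hu => by simpa [joinBranching] using h _ hu⟩
  · rintro ⟨hroot, h₀, h₁⟩ (_ | ⟨a, u⟩) hu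
    · exact hroot hu
    · obtain rfl | rfl := Bool.eq_or_eq_not a b
      · simpa [joinBranching] using h₁ u hu
      · simpa [joinBranching] using h₀ u hu

lemma map_joinBranching (p : unitInterval) (b : Bool) :
    ((bernoulliMeasure true false p).prod ((branchingMeasure p).prod (branchingMeasure p))).map
      (joinBranching b) = branchingMeasure p := by
  refine Measure.eq_infinitePi _ fun s t ht => ?_
  have hbranch (a : Bool) : branchingMeasure p (Set.pi (finBranch a s) fun u => t (a :: u)) =
      ∏ u ∈ finBranch a s, bernoulliMeasure true false p (t (a :: u)) :=
    Measure.infinitePi_pi _ fun u _ => ht _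
  have hroot : bernoulliMeasure true false p {x | [] ∈ s → x ∈ t []} =
      if [] ∈ s then bernoulliMeasure true false p (t []) else 1 := by
    split_ifs with h <;> simp [h]
  rw [Measure.map_apply (measurable_joinBranching b)
    (MeasurableSet.pi s.countable_toSet fun u _ => ht u), joinBranching_preimage_pi,
    Measure.prod_prod, Measure.prod_prod, hbranch, hbranch, hroot, prod_eq_mul_prod_finBranch s]
  cases b <;> simp [mul_comm]

lemma map_restrict_mem_randomTree (p : unitInterval) (b : Bool) (v : Vertex) :
    ((branchingMeasure p).restrict {ω | b :: v ∈ randomTree ω}).map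
        (fun ω => (tailBranching (!b) ω, tailBranching b ω)) =
      ENNReal.ofReal p •
        (branchingMeasure p).prod ((branchingMeasure p).restrict {ω | v ∈ randomTree ω}) := by
  have hpre : joinBranching b ⁻¹' {ω | b :: v ∈ randomTree ω} =
      {true} ×ˢ Set.univ ×ˢ {ω | v ∈ randomTree ω} := by
    ext x
    simp [cons_mem_randomTree, tailBranching_joinBranching, joinBranching]
  have hsnd : (fun ω => (tailBranching (!b) ω, tailBranching b ω)) ∘ joinBranching b =
      Prod.snd := by
    funext x
    simp [tailBranching_joinBranching, tailBranching_not_joinBranching]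
  have htrue : bernoulliMeasure true false p {true} = ENNReal.ofReal p := by
    rw [bernoulliMeasure_apply_of_mem_of_notMem _ (measurableSet_singleton _) (by simp) (by simp)]
    exact (ENNReal.ofReal_eq_coe_nnreal p.2.1).symm
  conv_lhs => rw [← map_joinBranching p b]
  rw [Measure.restrict_map (measurable_joinBranching b) (measurableSet_mem_randomTree _),
    Measure.map_map ((measurable_tailBranching _).prodMk (measurable_tailBranching _))
      (measurable_joinBranching b), hsnd, hpre, ← Measure.prod_restrict, ← Measure.prod_restrict,
    Measure.map_snd_prod, Measure.restrict_apply_univ, htrue, Measure.restrict_univ]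

section Conditioned

variable {p : unitInterval}

lemma measure_cons_mem_randomTree (b : Bool) (v : Vertex) :
    branchingMeasure p {ω | b :: v ∈ randomTree ω} =
      ENNReal.ofReal p * branchingMeasure p {ω | v ∈ randomTree ω} := by
  have huniv := congrArg (· Set.univ) (map_restrict_mem_randomTree p b v)
  simpa [Measure.map_apply ((measurable_tailBranching _).prodMk (measurable_tailBranching _)),
    Measure.prod_apply] using huniv

lemma ae_mem_randomTree (v : Vertex) : ∀ᵐ ω ∂(conditionedMeasure p v), v ∈ randomTree ω :=
  ae_cond_mem (measurableSet_mem_randomTree v)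

variable (hp : 0 < p)
include hp

lemma measure_mem_randomTree_ne_zero (v : Vertex) :
    branchingMeasure p {ω | v ∈ randomTree ω} ≠ 0 := by
  induction v with
  | nil => simp [nil_mem_randomTree]
  | cons b v ih =>
    rw [measure_cons_mem_randomTree]
    exact mul_ne_zero (ENNReal.ofReal_pos.2 hp).ne' ih

lemma isProbabilityMeasure_conditionedMeasure (v : Vertex) :
    IsProbabilityMeasure (conditionedMeasure p v) :=
  cond_isProbabilityMeasure (measure_mem_randomTree_ne_zero hp v)

lemma map_conditionedMeasure_cons (b : Bool) (v : Vertex) :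
    (conditionedMeasure p (b :: v)).map (fun ω => (tailBranching (!b) ω, tailBranching b ω)) =
      (branchingMeasure p).prod (conditionedMeasure p v) := by
  rw [conditionedMeasure, ProbabilityTheory.cond, Measure.map_smul, map_restrict_mem_randomTree,
    measure_cons_mem_randomTree, conditionedMeasure, ProbabilityTheory.cond,
    Measure.prod_smul_right, smul_smul, ENNReal.mul_inv (.inr (measure_ne_top _ _))
      (.inl ENNReal.ofReal_ne_top), mul_right_comm,
    ENNReal.inv_mul_cancel (ENNReal.ofReal_pos.2 hp).ne' ENNReal.ofReal_ne_top, one_mul]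

lemma lintegral_pathKernel_cons (b : Bool) (v : Vertex) (r₁ r₂ : ℝ) :
    ∫⁻ ω, ENNReal.ofReal (pathKernel (b :: v) r₁ r₂ (randomTree ω))
        ∂(conditionedMeasure p (b :: v)) =
      ∫⁻ ω, ∫⁻ ω', ENNReal.ofReal (pathKernel v (r₁ * (1 + theta (randomTree ω)) + r₂)
        (r₁ * theta (randomTree ω) + r₂) (randomTree ω')) ∂(conditionedMeasure p v)
        ∂(branchingMeasure p) := by
  have := isProbabilityMeasure_conditionedMeasure hp v
  have hmeas : Measurable fun x : Branching × Branching =>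
      ENNReal.ofReal (pathKernel v (r₁ * (1 + theta (randomTree x.1)) + r₂)
        (r₁ * theta (randomTree x.1) + r₂) (randomTree x.2)) := by
    have hθ : Measurable fun x : Branching × Branching => theta (randomTree x.1) :=
      measurable_theta_randomTree.comp measurable_fst
    have hx : Measurable fun x : Branching × Branching => treeRatio (randomTree x.2) :=
      measurable_treeRatio_randomTree.comp measurable_snd
    have hδ : Measurable fun x : Branching × Branching => pathDelta v (randomTree x.2) :=
      (measurable_pathDelta_randomTree v).comp measurable_snd
    unfold pathKernel
    fun_prop
  rw [← lintegral_prod _ hmeas.aemeasurable, ← map_conditionedMeasure_cons hp b v,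
    lintegral_map hmeas ((measurable_tailBranching _).prodMk (measurable_tailBranching _))]
  refine lintegral_congr_ae ?_
  filter_upwards [ae_mem_randomTree (b :: v)] with ω hω
  have hroot := (cons_mem_randomTree.1 hω).1
  rw [pathKernel_cons (nil_mem_randomTree ω), branch_randomTree hroot, branch_randomTree hroot]

lemma lintegral_pathKernel_mem_Icc (v : Vertex) {r₁ r₂ : ℝ} (hr₂ : 0 < r₂) (hle : r₂ ≤ r₁) :
    ∫⁻ ω, ENNReal.ofReal (pathKernel v r₁ r₂ (randomTree ω)) ∂(conditionedMeasure p v) ∈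
      Set.Icc
        (ENNReal.ofReal (3 / 4) *
          matrixMoment (branchingMeasure p) (fun ω => theta (randomTree ω)) v.length r₁ r₂)
        (ENNReal.ofReal 4 *
          matrixMoment (branchingMeasure p) (fun ω => theta (randomTree ω)) v.length r₁ r₂) := by
  induction v generalizing r₁ r₂ with
  | nil =>
    have := isProbabilityMeasure_conditionedMeasure hp []
    rw [List.length_nil, matrixMoment, ← ENNReal.ofReal_mul (by norm_num),
      ← ENNReal.ofReal_mul (by norm_num)]
    have hmem (ω : Branching) := pathKernel_nil_mem_Icc hr₂ hle (randomTree ω)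
    constructor
    · refine le_trans (by simp) (lintegral_mono fun ω => ENNReal.ofReal_le_ofReal (hmem ω).1)
    · refine (lintegral_mono fun ω => ENNReal.ofReal_le_ofReal (hmem ω).2).trans (by simp)
  | cons b v ih =>
    have hr₁ := hr₂.trans_le hle
    have hstep (ω : Branching) := ih (r₁ := r₁ * (1 + theta (randomTree ω)) + r₂)
      (r₂ := r₁ * theta (randomTree ω) + r₂)
      (by have hθ := theta_pos (randomTree ω); positivity) (by nlinarith)
    rw [lintegral_pathKernel_cons hp, List.length_cons, matrixMoment,
      ← lintegral_const_mul' _ _ ENNReal.ofReal_ne_top,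
      ← lintegral_const_mul' _ _ ENNReal.ofReal_ne_top]
    exact ⟨lintegral_mono fun ω => (hstep ω).1, lintegral_mono fun ω => (hstep ω).2⟩

end Conditioned

/-! ### The annealed covariance -/

lemma abs_heightCov_le (μ : ProbabilityMeasure Config) (u v : Vertex) : |heightCov μ u v| ≤ 9 := by
  have hmem (h : Fin 4) : height h ∈ Set.Icc (0 : ℝ) 3 :=
    ⟨Nat.cast_nonneg _, by rw [height]; exact_mod_cast Nat.le_of_lt_succ h.isLt⟩
  have hmean (w : Vertex) : ∫ η, height (η w) ∂(μ : Measure Config) ∈ Set.Icc (0 : ℝ) 3 :=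
    ⟨integral_nonneg fun η => (hmem _).1, by
      simpa using integral_mono ((memLp_height μ w).integrable one_le_two)
        (integrable_const (3 : ℝ)) fun η => (hmem (η w)).2⟩
  have hdev (w : Vertex) (η : Config) :
      |height (η w) - ∫ η, height (η w) ∂(μ : Measure Config)| ≤ 3 :=
    abs_sub_le_of_nonneg_of_le (hmem _).1 (hmem _).2 (hmean w).1 (hmean w).2
  have hbound : |heightCov μ u v| ≤ 3 * 3 * (μ : Measure Config).real Set.univ := by
    rw [heightCov, covariance, ← Real.norm_eq_abs]
    refine norm_integral_le_of_norm_le_const (Eventually.of_forall fun η => ?_)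
    rw [norm_mul]
    exact mul_le_mul (hdev u η) (hdev v η) (abs_nonneg _) zero_le_three
  rw [probReal_univ] at hbound
  linarith

section AnnealedCovariance

variable {p : unitInterval} (hp : 0 < p) {μ : Set Vertex → ProbabilityMeasure Config}
  (hμ : ∀ T, IsRootedSubtree T → IsSandpileMeasure T (μ T))
include hp hμ

lemma integrable_heightCov_randomTree (v : Vertex) :
    Integrable (fun ω => heightCov (μ (randomTree ω)) [] v) (conditionedMeasure p v) := by
  have := isProbabilityMeasure_conditionedMeasure hp v
  exact Integrable.of_bound (measurable_heightCov_randomTree hμ [] v).aestronglyMeasurable 9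
    (Eventually.of_forall fun ω => abs_heightCov_le _ _ _)

lemma annealedAbsCov_pos (v : Vertex) : 0 < annealedAbsCov p μ v := by
  have := isProbabilityMeasure_conditionedMeasure hp v
  refine (integral_pos_iff_support_of_nonneg (fun ω => abs_nonneg _)
    (integrable_heightCov_randomTree hp hμ v).abs).2 ?_
  have hsupp : ∀ᵐ ω ∂(conditionedMeasure p v),
      ω ∈ Function.support fun ω => |heightCov (μ (randomTree ω)) [] v| := by
    filter_upwards [ae_mem_randomTree v] with ω hω
    have hT := isRootedSubtree_randomTree ω
    exact abs_ne_zero.2 (heightCov_ne_zero hT (hμ _ hT) hω)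
  have huniv : Function.support (fun ω => |heightCov (μ (randomTree ω)) [] v|)
      =ᵐ[conditionedMeasure p v] Set.univ := eventuallyEq_univ.2 hsupp
  rw [measure_congr huniv, measure_univ]
  exact one_pos

lemma annealedAbsCov_cons_mem_Icc (b : Bool) (v : Vertex) :
    annealedAbsCov p μ (b :: v) ∈ Set.Icc
      (3 / 4 * moment (branchingMeasure p) (fun ω => theta (randomTree ω)) (b :: v).length)
      (12 * moment (branchingMeasure p) (fun ω => theta (randomTree ω)) (b :: v).length) := by
  have hmem : ∀ᵐ ω ∂(conditionedMeasure p (b :: v)),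
      |heightCov (μ (randomTree ω)) [] (b :: v)| ∈ Set.Icc (pathKernel (b :: v) 1 1 (randomTree ω))
        (3 * pathKernel (b :: v) 1 1 (randomTree ω)) := by
    filter_upwards [ae_mem_randomTree (b :: v)] with ω hω
    have hT := isRootedSubtree_randomTree ω
    exact abs_heightCov_cons_mem_Icc hT (hμ _ hT) hω
  have hK := lintegral_pathKernel_mem_Icc hp (b :: v) one_pos (le_refl (1 : ℝ))
  rw [← ENNReal.ofReal_toReal (matrixMoment_ne_top (P := branchingMeasure p)
    (fun ω => (theta_pos (randomTree ω)).le) one_pos one_pos (b :: v).length),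
    ← moment] at hK
  set m := moment (branchingMeasure p) (fun ω => theta (randomTree ω)) (b :: v).length
  have hm : 0 ≤ m := ENNReal.toReal_nonneg
  have hcov : ENNReal.ofReal (annealedAbsCov p μ (b :: v)) =
      ∫⁻ ω, ENNReal.ofReal |heightCov (μ (randomTree ω)) [] (b :: v)|
        ∂(conditionedMeasure p (b :: v)) :=
    ofReal_integral_eq_lintegral_ofReal (integrable_heightCov_randomTree hp hμ _).abs
      (Eventually.of_forall fun ω => abs_nonneg _)
  constructor
  · rw [← ENNReal.ofReal_le_ofReal_iff (annealedAbsCov_pos hp hμ _).le,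
      ENNReal.ofReal_mul (by norm_num), hcov]
    refine hK.1.trans (lintegral_mono_ae ?_)
    filter_upwards [hmem] with ω hω using ENNReal.ofReal_le_ofReal hω.1
  · rw [← ENNReal.ofReal_le_ofReal_iff (by positivity), hcov]
    calc ∫⁻ ω, ENNReal.ofReal |heightCov (μ (randomTree ω)) [] (b :: v)|
          ∂(conditionedMeasure p (b :: v))
        ≤ ∫⁻ ω, ENNReal.ofReal 3 * ENNReal.ofReal (pathKernel (b :: v) 1 1 (randomTree ω))
          ∂(conditionedMeasure p (b :: v)) := by
          refine lintegral_mono_ae ?_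
          filter_upwards [hmem] with ω hω
          rw [← ENNReal.ofReal_mul (by norm_num)]
          exact ENNReal.ofReal_le_ofReal hω.2
      _ ≤ ENNReal.ofReal 3 * (ENNReal.ofReal 4 * ENNReal.ofReal m) := by
          rw [lintegral_const_mul' _ _ ENNReal.ofReal_ne_top]
          exact mul_le_mul_right hK.2 _
      _ = ENNReal.ofReal (12 * m) := by
          rw [← ENNReal.ofReal_mul (by norm_num), ← ENNReal.ofReal_mul (by norm_num), ← mul_assoc]
          norm_num

end AnnealedCovariance

lemma tendsto_neg_log_div_of_mem_Icc {a b : ℕ → ℝ} {c C L : ℝ} (hc : 0 < c)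
    (ha : ∀ n, 0 < a n) (hab : ∀ᶠ n in atTop, b n ∈ Set.Icc (c * a n) (C * a n))
    (hlim : Tendsto (fun n : ℕ => -Real.log (a n) / n) atTop (𝓝 L)) :
    Tendsto (fun n : ℕ => (1 / (n : ℝ)) * -Real.log (b n)) atTop (𝓝 L) := by
  have hshift (d : ℝ) :
      Tendsto (fun n : ℕ => -Real.log (a n) / n - Real.log d / n) atTop (𝓝 L) := by
    simpa using hlim.sub (tendsto_const_div_atTop_nhds_zero_nat (Real.log d))
  refine tendsto_of_tendsto_of_tendsto_of_le_of_le' (hshift C) (hshift c) ?_ ?_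
  all_goals
    filter_upwards [hab] with n hn
    have hca := mul_pos hc (ha n)
    have hCa := hca.trans_le (hn.1.trans hn.2)
    rw [← sub_div, one_div_mul_eq_div]
    refine div_le_div_of_nonneg_right ?_ n.cast_nonneg
  · have hlog := Real.log_le_log (hca.trans_le hn.1) hn.2
    rw [Real.log_mul (pos_of_mul_pos_left hCa (ha n).le).ne' (ha n).ne'] at hlog
    linarith
  · have hlog := Real.log_le_log hca hn.1
    rw [Real.log_mul hc.ne' (ha n).ne'] at hlog
    linarith

/-! ### Bounds on the rate -/

lemma integral_theta_randomTree_mem_Icc (p : unitInterval) :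
    ∫ ω, theta (randomTree ω) ∂(branchingMeasure p) ∈ Set.Icc (1 / 2 : ℝ) (2 / 3) := by
  have hintegrable := integrable_theta_randomTree p
  constructor
  · simpa using integral_mono (integrable_const (1 / 2 : ℝ)) hintegrable
      fun ω => half_le_theta (randomTree ω)
  · simpa using integral_mono hintegrable (integrable_const (2 / 3 : ℝ))
      fun ω => theta_le_two_thirds (nil_mem_randomTree ω)

lemma integral_theta_randomTree_pos (p : unitInterval) :
    0 < ∫ ω, theta (randomTree ω) ∂(branchingMeasure p) :=
  one_half_pos.trans_le (integral_theta_randomTree_mem_Icc p).1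

lemma exists_tendsto_neg_log_annealedAbsCov {p : unitInterval} (hp : 0 < p)
    {μ : Set Vertex → ProbabilityMeasure Config}
    (hμ : ∀ T, IsRootedSubtree T → IsSandpileMeasure T (μ T)) {v : ℕ → Vertex}
    (hv : ∀ n, (v n).length = n) : ∃ L : ℝ,
      Tendsto (fun n : ℕ => (1 / (n : ℝ)) * -Real.log (annealedAbsCov p μ (v n))) atTop (𝓝 L) ∧
        L ≤ Real.log (growth (∫ ω, theta (randomTree ω) ∂(branchingMeasure p)) ^ 2) := by
  have hθ (ω : Branching) := (theta_pos (randomTree ω)).le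
  have hintegrable := integrable_theta_randomTree p
  have hm := integral_theta_randomTree_pos p
  obtain ⟨L, hL, hle⟩ := exists_tendsto_neg_log_moment hθ hintegrable hm
  refine ⟨L, tendsto_neg_log_div_of_mem_Icc (c := 3 / 4) (C := 12) (by norm_num)
    (moment_pos hθ hintegrable hm) ?_ hL, hle⟩
  filter_upwards [eventually_ne_atTop 0] with n hn
  obtain ⟨b, w, hw⟩ := List.exists_cons_of_length_pos (l := v n) (by rw [hv]; lia)
  have hmem := annealedAbsCov_cons_mem_Icc hp hμ b w
  rwa [← hw, hv n] at hmem

lemma LambdaPlus_div_LambdaMinus_inv {m : ℝ} (hm : 0 < m) :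
    LambdaPlus m⁻¹ / LambdaMinus m⁻¹ = growth m ^ 2 := by
  have hsqrt : √(m ^ 2 + 4 * m) = m * √(4 * m⁻¹ + 1) := by
    rw [show m ^ 2 + 4 * m = m ^ 2 * (4 * m⁻¹ + 1) by field_simp; ring,
      Real.sqrt_mul (sq_nonneg m), Real.sqrt_sq hm.le]
  have hplus : LambdaPlus m⁻¹ = growth m / m := by
    rw [LambdaPlus, growth, hsqrt]
    field_simp
  have hdet : LambdaPlus m⁻¹ * LambdaMinus m⁻¹ = m⁻¹ ^ 2 := by
    rw [LambdaPlus, LambdaMinus]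
    linear_combination -(1 / 4 : ℝ) * Real.sq_sqrt (by positivity : 0 ≤ 4 * m⁻¹ + 1)
  have hg : growth m ≠ 0 := (zero_lt_one.trans (one_lt_growth hm)).ne'
  have hminus : LambdaMinus m⁻¹ = (growth m * m)⁻¹ := by
    rw [hplus] at hdet
    field_simp at hdet ⊢
    linarith
  rw [hplus, hminus]
  field_simp

lemma LambdaPlus_div_LambdaMinus_gammaOf_ratioLaw (p : unitInterval) :
    LambdaPlus (gammaOf (ratioLaw p)) / LambdaMinus (gammaOf (ratioLaw p)) =
      growth (∫ ω, theta (randomTree ω) ∂(branchingMeasure p)) ^ 2 := by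
  rw [gammaOf_ratioLaw, LambdaPlus_div_LambdaMinus_inv (integral_theta_randomTree_pos p)]

lemma growth_sq_le {m : ℝ} (hm₀ : 0 < m) (hm : m ≤ 2 / 3) :
    growth m ^ 2 ≤ (4 + √7) / (4 - √7) := by
  have hsq := Real.sq_sqrt (by norm_num : (0 : ℝ) ≤ 7)
  have hlt : √7 < 4 := (Real.sqrt_lt' (by norm_num)).2 (by norm_num)
  have hsqrt : √(m ^ 2 + 4 * m) ≤ 2 * √7 / 3 := Real.sqrt_le_iff.2 ⟨by positivity, by nlinarith⟩
  have hg : growth m ≤ (4 + √7) / 3 := by rw [growth]; linarith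
  calc growth m ^ 2
      ≤ ((4 + √7) / 3) ^ 2 := by
        gcongr
        exact (zero_lt_one.trans (one_lt_growth hm₀)).le
    _ = (4 + √7) / (4 - √7) := by
        rw [eq_div_iff (by linarith)]
        linear_combination (-(4 + √7) / 9) * hsq

lemma log_growth_sq_le (p : unitInterval) :
    Real.log (growth (∫ ω, theta (randomTree ω) ∂(branchingMeasure p)) ^ 2) ≤
      Real.log ((4 + √7) / (4 - √7)) := by
  have hm := integral_theta_randomTree_pos p
  exact Real.log_le_log (pow_pos (zero_lt_one.trans (one_lt_growth hm)) 2)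
    (growth_sq_le hm (integral_theta_randomTree_mem_Icc p).2)

end TreeSandpile

end

theorem theorem6p2 (p : unitInterval) (hp : 0 < p) (v : ℕ → TreeSandpile.Vertex)
    (hv : ∀ n, (v n).length = n) :
    ∃ (ν : ProbabilityMeasure ℝ)
      (μ : Set TreeSandpile.Vertex → ProbabilityMeasure TreeSandpile.Config),
      -- the characteristic ratio of the tree of `N` generations has the limiting law `ν`
      TendstoInDistribution
        (fun (N : ℕ) ω => TreeSandpile.charRatio (TreeSandpile.randomTreeUpTo N ω)) atTop
        (id : ℝ → ℝ) (fun _ => TreeSandpile.branchingMeasure p) (ν : Measure ℝ) ∧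
      -- the sandpile measure `μ T` of every finite or infinite rooted subtree `T` exists
      (∀ T, TreeSandpile.IsRootedSubtree T → TreeSandpile.IsSandpileMeasure T (μ T)) ∧
      -- the annealed covariances are well defined and do not vanish
      (∀ n, Integrable
        (fun ω => TreeSandpile.heightCov (μ (TreeSandpile.randomTree ω)) [] (v n))
        (TreeSandpile.conditionedMeasure p (v n))) ∧
      (∀ n, 0 < TreeSandpile.annealedAbsCov p μ (v n)) ∧
      ∃ L : ℝ,
        Tendsto (fun n : ℕ => (1 / (n : ℝ)) *
          (-Real.log (TreeSandpile.annealedAbsCov p μ (v n)))) atTop (𝓝 L) ∧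
        L ≤ Real.log (TreeSandpile.LambdaPlus (TreeSandpile.gammaOf ν) /
          TreeSandpile.LambdaMinus (TreeSandpile.gammaOf ν)) ∧
        Real.log (TreeSandpile.LambdaPlus (TreeSandpile.gammaOf ν) /
          TreeSandpile.LambdaMinus (TreeSandpile.gammaOf ν)) ≤
            Real.log ((4 + √7) / (4 - √7)) := by
  choose! μ hμ using fun T (hT : TreeSandpile.IsRootedSubtree T) =>
    TreeSandpile.exists_isSandpileMeasure hT
  obtain ⟨L, hL, hle⟩ := TreeSandpile.exists_tendsto_neg_log_annealedAbsCov hp hμ hv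
  have hrate := TreeSandpile.LambdaPlus_div_LambdaMinus_gammaOf_ratioLaw p
  exact ⟨TreeSandpile.ratioLaw p, μ, TreeSandpile.tendstoInDistribution_charRatio p, hμ,
    fun n => TreeSandpile.integrable_heightCov_randomTree hp hμ (v n),
    fun n => TreeSandpile.annealedAbsCov_pos hp hμ (v n), L, hL, hrate ▸ hle,
    hrate ▸ TreeSandpile.log_growth_sq_le p⟩
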